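/- **Theorem 1.** In the synchronous $\mathrm{KT}_1$ LOCAL model there is a randomized Monte Carlo algorithm that, with high probability, constructs a BFS tree from a designated root in $O(D\log n+\log^3 n)$ rounds using $O(n\log^3 n)$ messages, where $n$ is the number of nodes and $D$ the diameter of the network. Precisely: the network is a connected undirected graph $G$ with $n$ nodes and diameter $D$. The nodes have pairwise distinct identifiers in $\{0,\dots,N-1\}$, where $N\le n^{a}$ for a constant $a$. Initially a node knows only $N$, its own identifier, the identifiers of its neighbors, whether it is the root $r$, and an infinite sequence of private random bits; all bits of all nodes are independent and fair. In each round every node that has not halted may send one message of arbitrary size to each of its neighbors, receives the messages sent to it in that round together with the identifiers of their senders, and performs arbitrary local computation. A node that has halted keeps its output and sends nothing. For every constant $c\in\mathbb{N}$ there is an algorithm $\mathcal{A}$ such that for every constant $a\in\mathbb{N}$ there is a constant $C$ such that, on every network as above, the following holds with probability at least $1-n^{-c}$: after at most $C\,(D\log n+\log^3 n)$ rounds all nodes have halted; at most $C\,n\log^3 n$ messages have been sent in total; and the outputs describe a BFS tree of $G$ rooted at $r$, that is, there is a spanning tree $T$ of $G$ with $\mathrm{dist}_T(r,v)=\mathrm{dist}_G(r,v)$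 for all nodes $v$, such that every node outputs the identifier of its parent in $T$ (the root outputs that it has none) and the set of identifiers of its children in $T$. -/

import Mathlib

open MeasureTheory ProbabilityTheory

namespace KT1Local

/-- A network on the node set `V`: an undirected communication graph, pairwise distinct node
identifiers taken from the identifier space `{0, …, idBound - 1}`, and a designated root. -/
structure Network (V : Type) where
  graph : SimpleGraph V
  idBound : ℕ
  ident : V → ℕ
  ident_injective : Function.Injective ident
  ident_lt : ∀ v, ident v < idBound
  root : V

/-- What a node knows before the first round in the KT1 model: the size of the identifier space,
its own identifier, the identifiers of its neighbors, whether it is itself the designated root,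
and its private infinite sequence of random bits. -/
structure LocalInput where
  idBound : ℕ
  ownId : ℕ
  neighborIds : Finset ℕ
  isRoot : Prop
  coins : ℕ → Bool

/-- A distributed algorithm for the synchronous LOCAL model: the code run by every node.
Local computation and message size are unrestricted. In a round, a node in state `s` sends
`send s i` to its neighbor with identifier `i` (`none` means that no message is sent), and moves
to the state `receive s M`, where `M` is the set of pairs (identifier of the sender, message) of
the messages that reach it in that round. A node has halted once `output` is `some _`. -/
structure Algorithm (Out : Type) where
  State : Type
  Msg : Type
  init : LocalInput → State
  send : State → ℕ → Option Msg
  receive : State → Set (ℕ × Msg) → State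
  output : State → Option Out

section Execution

variable {V Out : Type}

open Classical in
/-- The initial knowledge of node `v` when its private random bits are `coins`. -/
noncomputable def Network.input [Fintype V] (𝒩 : Network V) (coins : ℕ → Bool) (v : V) :
    LocalInput where
  idBound := 𝒩.idBound
  ownId := 𝒩.ident v
  neighborIds := (Finset.univ.filter fun u => 𝒩.graph.Adj v u).image 𝒩.ident
  isRoot := v = 𝒩.root
  coins := coins

/-- The message which a node in state `s` sends to its neighbor with identifier `i`.
A node that has halted sends nothing. -/
def Algorithm.message (A : Algorithm Out) (s : A.State) (i : ℕ) : Option A.Msg :=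
  match A.output s with
  | some _ => none
  | none => A.send s i

/-- The messages that reach `v` in a round that starts in the configuration `σ`, each one
together with the identifier of its sender. -/
def Algorithm.inbox (A : Algorithm Out) (𝒩 : Network V) (σ : V → A.State) (v : V) :
    Set (ℕ × A.Msg) :=
  {p | ∃ u, 𝒩.graph.Adj u v ∧ p.1 = 𝒩.ident u ∧ A.message (σ u) (𝒩.ident v) = some p.2}

/-- The configuration after one more round. A node that has halted keeps its state. -/
def Algorithm.step (A : Algorithm Out) (𝒩 : Network V) (σ : V → A.State) : V → A.State :=
  fun v => match A.output (σ v) with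
    | some _ => σ v
    | none => A.receive (σ v) (A.inbox 𝒩 σ v)

/-- The configuration after `t` rounds when node `v` has the random bits `ω v`. -/
noncomputable def Algorithm.config [Fintype V] (A : Algorithm Out) (𝒩 : Network V)
    (ω : V → ℕ → Bool) : ℕ → V → A.State
  | 0 => fun v => A.init (𝒩.input (ω v) v)
  | t + 1 => A.step 𝒩 (A.config 𝒩 ω t)

/-- The number of messages sent in a round that starts in the configuration `σ`. -/
noncomputable def Algorithm.roundMessages (A : Algorithm Out) (𝒩 : Network V)
    (σ : V → A.State) : ℕ :=
  Set.ncard {p : V × V | 𝒩.graph.Adj p.1 p.2 ∧ A.message (σ p.1) (𝒩.ident p.2) ≠ none}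

/-- The total number of messages sent by all nodes in the first `T` rounds. -/
noncomputable def Algorithm.messages [Fintype V] (A : Algorithm Out) (𝒩 : Network V)
    (ω : V → ℕ → Bool) (T : ℕ) : ℕ :=
  ∑ t ∈ Finset.range T, A.roundMessages 𝒩 (A.config 𝒩 ω t)

/-- After `T` rounds every node has halted, and the output of node `v` is `out v`. -/
def Algorithm.HaltsWith [Fintype V] (A : Algorithm Out) (𝒩 : Network V)
    (ω : V → ℕ → Bool) (T : ℕ) (out : V → Out) : Prop :=
  ∀ v, A.output (A.config 𝒩 ω T v) = some (out v)

end Execution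

/-- The uniform distribution of the random bits: all bits of all nodes are independent and fair. -/
noncomputable def coinMeasure (V : Type) [Fintype V] : Measure (V → ℕ → Bool) :=
  Measure.pi fun _ : V => Measure.infinitePi fun _ : ℕ => (PMF.uniformOfFintype Bool).toMeasure

/-- `T` is a breadth-first search tree of `G` with root `r`: a spanning tree of `G` in which every
node has the same distance from `r` as in `G`. -/
def IsBFSTree {V : Type} (G : SimpleGraph V) (r : V) (T : SimpleGraph V) : Prop :=
  T ≤ G ∧ T.IsTree ∧ ∀ v, T.dist r v = G.dist r v

/-- The local output of a node in a distributed representation of a rooted tree: the identifier of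
its parent (`none` at the root) and the identifiers of its children. -/
structure TreeOutput where
  parent : Option ℕ
  children : Finset ℕ

/-- The local outputs `out` represent the tree `T`, rooted at the root of the network: every node
knows its parent and its children. -/
def Represents {V : Type} (𝒩 : Network V) (T : SimpleGraph V) (out : V → TreeOutput) : Prop :=
  (out 𝒩.root).parent = none ∧
  (∀ v, v ≠ 𝒩.root → ∃ p, T.Adj v p ∧ T.dist 𝒩.root v = T.dist 𝒩.root p + 1 ∧
    (out v).parent = some (𝒩.ident p)) ∧
  (∀ v i, i ∈ (out v).children ↔
    ∃ w, T.Adj v w ∧ T.dist 𝒩.root w = T.dist 𝒩.root v + 1 ∧ i = 𝒩.ident w)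

/-- The execution of `A` on `𝒩` with the random bits `ω` ends after at most `R` rounds, uses at
most `M` messages in total, and constructs a BFS tree from the root of `𝒩`. -/
def Algorithm.BuildsBFSTreeWithin {V : Type} [Fintype V] (A : Algorithm TreeOutput)
    (𝒩 : Network V) (ω : V → ℕ → Bool) (R M : ℝ) : Prop :=
  ∃ (t : ℕ) (out : V → TreeOutput) (T : SimpleGraph V),
    (t : ℝ) ≤ R ∧ A.HaltsWith 𝒩 ω t out ∧ (A.messages 𝒩 ω t : ℝ) ≤ M ∧
    IsBFSTree 𝒩.graph 𝒩.root T ∧ Represents 𝒩 T out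

end KT1Local

namespace KT1Local

/-! ### Greedy spanners: stretch and size. -/

section Spanner

variable {V : Type}

/-! Randomness is not needed. Messages are unbounded and every node knows its neighbors'
identifiers, so it suffices that every node learns the whole network; each then computes the same
BFS tree locally and reads off its own output. The cost lies in spreading the facts, and this is
done over a sparse spanner of `G` with logarithmic stretch.

The spanner is greedy, with `k = 2 * phases N` for the identifier bound `N`: in each phase every
node links to one neighbor at spanner distance more than `k`, if it has one. If an edge at `u` is
still stretched beyond `k` after `i` phases, the ball of radius `i` around `u` has at least `2 ^ i`
nodes (`two_pow_le_ball`). After `phases N` phases this would exceed the number of nodes, so every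
edge is stretched by at most `k` (`within_spanner`). A phase adds at most one link per node
(`ncard_spanner_adj_le`), hence the spanner has `O(n log n)` edges. A phase takes one linking round
and `k` rounds of flooding identifiers, all along links of the final spanner (`config_in_phase`,
`roundMessages_le_of_lt_spannerTime`): `O(log² n)` rounds and `O(n log³ n)` messages.

Then a wave from the root layers the spanner by distance, facts are gathered from the farthest
layers inwards, and the root broadcasts everything. Each node passes through levels `1, 2, 3` and
speaks only when its level rises, so a link carries at most three messages in each direction. The
invariant `known_invariant` shows that a node of level `3` knows all facts; `level_eq_three` shows
that this level is reached after `3 * m + 1` rounds, where `m` bounds the spanner distance from the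
root. By the stretch, `m = O(D log n)` is possible. From complete facts, `exists_tree_represents`
gives the BFS tree. For at least two nodes the failure event is therefore empty. -/

/-- `v` can be reached from `u` by a walk of length at most `k`. -/
def Within (H : SimpleGraph V) (k : ℕ) (u v : V) : Prop := ∃ p : H.Walk u v, p.length ≤ k

theorem Within.symm {H : SimpleGraph V} {k : ℕ} {u v : V} (h : Within H k u v) :
    Within H k v u := by
  obtain ⟨p, hp⟩ := h
  exact ⟨p.reverse, by simpa using hp⟩

theorem Within.trans {H : SimpleGraph V} {k l : ℕ} {u v w : V} (h : Within H k u v)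
    (h' : Within H l v w) : Within H (k + l) u w := by
  obtain ⟨p, hp⟩ := h
  obtain ⟨q, hq⟩ := h'
  exact ⟨p.append q, by rw [SimpleGraph.Walk.length_append]; omega⟩

theorem Within.mono {H H' : SimpleGraph V} {k l : ℕ} {u v : V} (h : Within H k u v)
    (hH : H ≤ H') (hk : k ≤ l) : Within H' l u v := by
  obtain ⟨p, hp⟩ := h
  exact ⟨p.mapLe hH, by simpa using hp.trans hk⟩

theorem Within.refl (H : SimpleGraph V) (k : ℕ) (u : V) : Within H k u u :=
  ⟨SimpleGraph.Walk.nil, by simp⟩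

theorem within_of_adj {H : SimpleGraph V} {u v : V} (h : H.Adj u v) : Within H 1 u v :=
  ⟨SimpleGraph.Walk.cons h SimpleGraph.Walk.nil, by simp⟩

theorem within_zero {H : SimpleGraph V} {u v : V} : Within H 0 u v ↔ u = v := by
  constructor
  · rintro ⟨p, hp⟩
    exact SimpleGraph.Walk.eq_of_length_eq_zero (Nat.le_zero.mp hp)
  · rintro rfl
    exact Within.refl H 0 u

theorem within_bot {k : ℕ} {u v : V} : Within (⊥ : SimpleGraph V) k u v ↔ u = v := by
  constructor
  · rintro ⟨p, -⟩
    cases p with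
    | nil => rfl
    | cons h _ => exact absurd h (by simp)
  · rintro rfl
    exact Within.refl _ k u

/-- This is one round of flooding as seen by the receiver `u`: the ball grows by the balls of the
neighbors `w` that send to it. -/
theorem within_succ {H : SimpleGraph V} {k : ℕ} {u v : V} :
    Within H (k + 1) u v ↔ Within H k u v ∨ ∃ w, H.Adj w u ∧ Within H k w v := by
  constructor
  · rintro ⟨p, hp⟩
    cases p with
    | nil => exact Or.inl (Within.refl H k u)
    | cons h q => exact Or.inr ⟨_, h.symm, q, by simpa using hp⟩
  · rintro (h | ⟨w, hw, h⟩)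
    · exact h.mono le_rfl (Nat.le_succ k)
    · rw [add_comm]
      exact (within_of_adj hw.symm).trans h

/-- The neighbor `v` of `u` has the least identifier among those which are not within distance `k`
of `u` in `H`. -/
def LinkRel (G : SimpleGraph V) (ident : V → ℕ) (k : ℕ) (H : SimpleGraph V) (u v : V) : Prop :=
  IsLeast (ident '' {w | G.Adj u w ∧ ¬ Within H k u w}) (ident v)

/-- The greedy spanner: in every phase, every node links to its least neighbor at distance more
than `k`, if there is any. -/
def spanner (G : SimpleGraph V) (ident : V → ℕ) (k : ℕ) : ℕ → SimpleGraph V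
  | 0 => ⊥
  | i + 1 => spanner G ident k i ⊔ SimpleGraph.fromRel (LinkRel G ident k (spanner G ident k i))

variable {G : SimpleGraph V} {ident : V → ℕ} {k : ℕ}

theorem LinkRel.adj (hid : Function.Injective ident) {H : SimpleGraph V} {u v : V}
    (h : LinkRel G ident k H u v) : G.Adj u v ∧ ¬ Within H k u v := by
  obtain ⟨w, hw, hwv⟩ := h.1
  rwa [← hid hwv]

theorem LinkRel.unique (hid : Function.Injective ident) {H : SimpleGraph V} {u v w : V}
    (h : LinkRel G ident k H u v) (h' : LinkRel G ident k H u w) : v = w :=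
  hid (IsLeast.unique h h')

theorem exists_linkRel {H : SimpleGraph V} {u v : V} (h : G.Adj u v) (h' : ¬ Within H k u v) :
    ∃ w, LinkRel G ident k H u w := by
  have hne : (ident '' {w | G.Adj u w ∧ ¬ Within H k u w}).Nonempty := ⟨_, v, ⟨h, h'⟩, rfl⟩
  obtain ⟨w, hw, hwe⟩ := Nat.sInf_mem hne
  refine ⟨w, ⟨w, hw, rfl⟩, ?_⟩
  rw [hwe]
  exact fun x hx => Nat.sInf_le hx

theorem spanner_succ_adj (hid : Function.Injective ident) {i : ℕ} {u v : V} :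
    (spanner G ident k (i + 1)).Adj u v ↔ (spanner G ident k i).Adj u v ∨
      LinkRel G ident k (spanner G ident k i) u v ∨
      LinkRel G ident k (spanner G ident k i) v u := by
  simp only [spanner, SimpleGraph.sup_adj, SimpleGraph.fromRel_adj]
  constructor
  · rintro (h | ⟨-, h⟩) <;> tauto
  · rintro (h | h)
    · exact Or.inl h
    · refine Or.inr ⟨?_, h⟩
      rcases h with h | h
      · exact (h.adj hid).1.ne
      · exact (h.adj hid).1.ne'

theorem spanner_le (hid : Function.Injective ident) (i : ℕ) : spanner G ident k i ≤ G := by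
  induction i with
  | zero => exact bot_le
  | succ i ih =>
    intro u v h
    rcases (spanner_succ_adj hid).mp h with h | h | h
    · exact ih h
    · exact (h.adj hid).1
    · exact (h.adj hid).1.symm

theorem spanner_mono : Monotone (spanner G ident k) :=
  monotone_nat_of_le_succ fun _ => le_sup_left

/-- Doubling argument. If `u` still has a far neighbor, then in the current phase it linked to some
far neighbor `w`, possibly different from `v`. By induction the balls of radius `i` around `u` and
`w` are both large; they are disjoint, since a common point would give a path of length `2 * i ≤ k`.
The new link puts both into the ball of radius `i + 1` around `u`. -/
theorem two_pow_le_ball [Finite V] (hid : Function.Injective ident) {i : ℕ} (hi : 2 * i ≤ k)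
    {u v : V} (huv : G.Adj u v) (h : ¬ Within (spanner G ident k i) k u v) :
    2 ^ i ≤ Set.ncard {w | Within (spanner G ident k i) i u w} := by
  induction i generalizing u v with
  | zero =>
    rw [pow_zero, Nat.one_le_iff_ne_zero]
    exact Set.ncard_ne_zero_of_mem (a := u) (Within.refl _ _ _)
  | succ i ih =>
    have hle : spanner G ident k i ≤ spanner G ident k (i + 1) := spanner_mono (Nat.le_succ i)
    have hu : ¬ Within (spanner G ident k i) k u v := fun h' => h (h'.mono hle le_rfl)
    obtain ⟨w, hw⟩ := exists_linkRel (ident := ident) huv hu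
    obtain ⟨huw, hfar⟩ := hw.adj hid
    have h₁ := ih (by omega) huw hfar
    have h₂ := ih (by omega) huw.symm fun h' => hfar h'.symm
    have hdisj : Disjoint {x | Within (spanner G ident k i) i u x}
        {x | Within (spanner G ident k i) i w x} := by
      rw [Set.disjoint_left]
      intro x hx hx'
      exact hfar ((Within.trans hx (Within.symm hx')).mono le_rfl (by omega))
    rw [pow_succ, mul_two]
    refine (add_le_add h₁ h₂).trans ?_
    rw [← Set.ncard_union_eq hdisj]
    refine Set.ncard_le_ncard ?_
    rintro x (hx | hx)
    · exact Within.mono hx hle (Nat.le_succ i)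
    · have := within_of_adj ((spanner_succ_adj hid).mpr (Or.inr (Or.inl hw)))
      have h3 := this.trans (Within.mono hx hle le_rfl)
      exact h3.mono le_rfl (by omega)

theorem within_spanner [Finite V] (hid : Function.Injective ident) {i : ℕ} (hi : 2 * i ≤ k)
    (hn : Nat.card V < 2 ^ i) {u v : V} (huv : G.Adj u v) :
    Within (spanner G ident k i) k u v := by
  by_contra h
  exact absurd (two_pow_le_ball hid hi huv h) (not_le.mpr ((Set.ncard_le_card _).trans_lt hn))

/-- Each node chooses at most one link per phase. Links are counted as ordered pairs, because
messages travel in both directions; hence the factor `2`. -/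
theorem ncard_spanner_adj_le [Finite V] (hid : Function.Injective ident) (i : ℕ) :
    Set.ncard {p : V × V | (spanner G ident k i).Adj p.1 p.2} ≤ 2 * i * Nat.card V := by
  induction i with
  | zero => simp [spanner]
  | succ i ih =>
    have h₁ : Set.ncard {p : V × V | LinkRel G ident k (spanner G ident k i) p.1 p.2} ≤
        Nat.card V := by
      rw [← Set.ncard_univ]
      refine Set.ncard_le_ncard_of_injOn Prod.fst (fun _ _ => Set.mem_univ _) ?_
      rintro ⟨a, b⟩ h ⟨a', b'⟩ h' (rfl : a = a')
      exact Prod.ext rfl (LinkRel.unique hid h h')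
    have h₂ : Set.ncard {p : V × V | LinkRel G ident k (spanner G ident k i) p.2 p.1} ≤
        Nat.card V := by
      rw [← Set.ncard_univ]
      refine Set.ncard_le_ncard_of_injOn Prod.snd (fun _ _ => Set.mem_univ _) ?_
      rintro ⟨b, a⟩ h ⟨b', a'⟩ h' (rfl : a = a')
      exact Prod.ext (LinkRel.unique hid h h') rfl
    have hsub : {p : V × V | (spanner G ident k (i + 1)).Adj p.1 p.2} ⊆
        {p : V × V | (spanner G ident k i).Adj p.1 p.2} ∪
          ({p : V × V | LinkRel G ident k (spanner G ident k i) p.1 p.2} ∪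
            {p : V × V | LinkRel G ident k (spanner G ident k i) p.2 p.1}) := fun p hp =>
      (spanner_succ_adj hid).mp hp
    have h₃ := (Set.ncard_le_ncard hsub).trans (Set.ncard_union_le _ _)
    have h₄ := Set.ncard_union_le {p : V × V | LinkRel G ident k (spanner G ident k i) p.1 p.2}
      {p : V × V | LinkRel G ident k (spanner G ident k i) p.2 p.1}
    nlinarith

/-- If every edge is stretched by a factor of at most `k`, then so is every walk. -/
theorem within_mul_of_stretch {H : SimpleGraph V} (hs : ∀ u v, G.Adj u v → Within H k u v)
    {u v : V} (p : G.Walk u v) : Within H (p.length * k) u v := by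
  induction p with
  | nil => exact Within.refl _ _ _
  | cons h p ih =>
    rw [SimpleGraph.Walk.length_cons, add_mul, one_mul, add_comm]
    exact (hs _ _ h).trans ih

theorem dist_le_mul_of_stretch {H : SimpleGraph V} (hG : G.Connected)
    (hs : ∀ u v, G.Adj u v → Within H k u v) (u v : V) : H.dist u v ≤ G.dist u v * k := by
  obtain ⟨p, hp⟩ := hG.exists_walk_length_eq_dist u v
  obtain ⟨q, hq⟩ := within_mul_of_stretch hs p
  rw [← hp]
  exact (SimpleGraph.dist_le q).trans hq

theorem connected_of_stretch {H : SimpleGraph V} (hG : G.Connected)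
    (hs : ∀ u v, G.Adj u v → Within H k u v) : H.Connected := by
  have := hG.nonempty
  refine ⟨fun u v => ?_⟩
  obtain ⟨p⟩ := hG.preconnected u v
  obtain ⟨q, -⟩ := within_mul_of_stretch hs p
  exact ⟨q⟩

end Spanner

/-! ### BFS trees from parent functions. -/

section BFSTree

variable {V : Type}

/-- The graph whose edges join every node other than `r` to its parent. -/
def parentGraph (r : V) (par : V → V) : SimpleGraph V :=
  SimpleGraph.fromRel fun v w => v ≠ r ∧ par v = w

variable {G : SimpleGraph V} {r : V} {par : V → V}

theorem parentGraph_adj_par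
    (hpar : ∀ v, v ≠ r → G.Adj v (par v) ∧ G.dist r v = G.dist r (par v) + 1) {v : V}
    (hv : v ≠ r) : (parentGraph r par).Adj v (par v) :=
  (SimpleGraph.fromRel_adj _ _ _).mpr ⟨(hpar v hv).1.ne, Or.inl ⟨hv, rfl⟩⟩

/-- Every step to the parent lowers the distance to `r` by exactly one. The walk yields both the
connectedness of the parent graph and its distances from `r`. -/
theorem exists_parentGraph_walk (hG : G.Connected)
    (hpar : ∀ v, v ≠ r → G.Adj v (par v) ∧ G.dist r v = G.dist r (par v) + 1) (n : ℕ) (v : V)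
    (hn : G.dist r v = n) : ∃ p : (parentGraph r par).Walk v r, p.length = n := by
  induction n generalizing v with
  | zero =>
    obtain rfl := hG.dist_eq_zero_iff.mp hn
    exact ⟨SimpleGraph.Walk.nil, rfl⟩
  | succ n ih =>
    have hv : v ≠ r := by
      rintro rfl
      simp at hn
    obtain ⟨p, hp⟩ := ih (par v) (by have := (hpar v hv).2; omega)
    exact ⟨SimpleGraph.Walk.cons (parentGraph_adj_par hpar hv) p, by simp [hp]⟩

theorem parentGraph_le
    (hpar : ∀ v, v ≠ r → G.Adj v (par v) ∧ G.dist r v = G.dist r (par v) + 1) :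
    parentGraph r par ≤ G := by
  intro v w h
  obtain ⟨-, ⟨hv, rfl⟩ | ⟨hw, rfl⟩⟩ := (SimpleGraph.fromRel_adj _ _ _).mp h
  · exact (hpar v hv).1
  · exact (hpar w hw).1.symm

theorem isBFSTree_parentGraph [Finite V] (hG : G.Connected)
    (hpar : ∀ v, v ≠ r → G.Adj v (par v) ∧ G.dist r v = G.dist r (par v) + 1) :
    IsBFSTree G r (parentGraph r par) := by
  have hle := parentGraph_le hpar
  have hconn : (parentGraph r par).Connected := by
    have := hG.nonempty
    refine ⟨fun u v => ?_⟩
    obtain ⟨p, -⟩ := exists_parentGraph_walk hG hpar _ u rfl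
    obtain ⟨q, -⟩ := exists_parentGraph_walk hG hpar _ v rfl
    exact ⟨p.append q.reverse⟩
  refine ⟨hle, SimpleGraph.isTree_iff_connected_and_card.mpr ⟨hconn, le_antisymm ?_ ?_⟩, ?_⟩
  -- Each edge is charged to its child endpoint, so there are at most `n - 1` edges; a connected
  -- graph with that few edges is a tree.
  · have hsub : (parentGraph r par).edgeSet ⊆ (fun v => s(v, par v)) '' {v | v ≠ r} := by
      intro e
      induction e using Sym2.ind with
      | _ v w =>
        intro h
        obtain ⟨-, ⟨hv, rfl⟩ | ⟨hw, rfl⟩⟩ :=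
          (SimpleGraph.fromRel_adj _ _ _).mp ((parentGraph r par).mem_edgeSet.mp h)
        · exact ⟨v, hv, rfl⟩
        · exact ⟨w, hw, Sym2.eq_swap⟩
    have h₁ := (Set.ncard_le_ncard hsub).trans (Set.ncard_image_le (Set.toFinite _))
    have h₂ : Set.ncard {v : V | v ≠ r} < Nat.card V := by
      rw [← Set.ncard_univ]
      exact Set.ncard_lt_ncard (Set.ssubset_univ_iff.mpr fun h =>
        (h ▸ Set.mem_univ r : r ∈ {v : V | v ≠ r}) rfl)
    rw [Nat.card_coe_set_eq]
    omega
  · exact hconn.card_vert_le_card_edgeSet_add_one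
  · intro v
    refine le_antisymm ?_ ((hconn.preconnected r v).dist_anti hle)
    obtain ⟨p, hp⟩ := exists_parentGraph_walk hG hpar _ v rfl
    rw [← hp, SimpleGraph.dist_comm]
    exact SimpleGraph.dist_le p

theorem exists_adj_dist_succ (hG : G.Connected) {v : V} (hv : v ≠ r) :
    ∃ w, G.Adj v w ∧ G.dist r v = G.dist r w + 1 := by
  obtain ⟨p, hp⟩ := hG.exists_walk_length_eq_dist v r
  cases p with
  | nil => exact absurd rfl hv
  | @cons _ w _ h q =>
    refine ⟨w, h, ?_⟩
    have h₁ : G.dist r w ≤ q.length := by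
      rw [SimpleGraph.dist_comm]
      exact SimpleGraph.dist_le q
    have h₂ := hG.dist_triangle (u := v) (v := w) (w := r)
    rw [SimpleGraph.dist_eq_one_iff_adj.mpr h, SimpleGraph.dist_comm (u := w)] at h₂
    rw [SimpleGraph.Walk.length_cons] at hp
    rw [SimpleGraph.dist_comm (u := v)] at hp h₂
    omega

/-- A walk that starts in the image of `f` never leaves it and lifts to `G`. This transfers
distances to the graph on all of `ℕ` that nodes reconstruct from identifiers. -/
theorem dist_map_embedding {W : Type} (hG : G.Connected) (f : V ↪ W) (u v : V) :
    (G.map f).dist (f u) (f v) = G.dist u v := by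
  have key : ∀ {x y : W} (p : (G.map f).Walk x y) (u : V), f u = x →
      ∃ v, f v = y ∧ ∃ q : G.Walk u v, q.length = p.length := by
    intro x y p
    induction p with
    | nil => exact fun u hu => ⟨u, hu, SimpleGraph.Walk.nil, rfl⟩
    | cons h p ih =>
      rintro u rfl
      obtain ⟨a, b, hab, ha, rfl⟩ := (SimpleGraph.map_adj _ _ _ _).mp h
      obtain rfl := f.injective ha
      obtain ⟨v, hv, q, hq⟩ := ih b rfl
      exact ⟨v, hv, SimpleGraph.Walk.cons hab q, by simp [hq]⟩
  obtain ⟨p, hp⟩ := hG.exists_walk_length_eq_dist u v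
  have hle : (G.map f).dist (f u) (f v) ≤ G.dist u v := by
    rw [← hp]
    exact (SimpleGraph.dist_le (p.map (SimpleGraph.Embedding.map f G).toHom)).trans_eq
      (SimpleGraph.Walk.length_map _ _)
  refine le_antisymm hle ?_
  have hr : (G.map f).Reachable (f u) (f v) :=
    ⟨p.map (SimpleGraph.Embedding.map f G).toHom⟩
  obtain ⟨q, hq⟩ := hr.exists_walk_length_eq_dist
  obtain ⟨v', hv', q', hq'⟩ := key q u rfl
  obtain rfl := f.injective hv'
  rw [← hq, ← hq']
  exact SimpleGraph.dist_le q'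

end BFSTree

/-! ### Computing the output from complete knowledge of the network. -/

section Facts

/-- What a node can tell the others about itself. -/
structure Fact where
  id : ℕ
  nbrs : Finset ℕ
  isRoot : Prop

def LocalInput.fact (x : LocalInput) : Fact := ⟨x.ownId, x.neighborIds, x.isRoot⟩

/-- The graph on the identifiers which a set of facts describes. -/
def factGraph (S : Set Fact) : SimpleGraph ℕ :=
  SimpleGraph.fromRel fun i j => ∃ f ∈ S, f.id = i ∧ j ∈ f.nbrs

noncomputable def rootId (S : Set Fact) : ℕ := sInf {i | ∃ f ∈ S, f.id = i ∧ f.isRoot}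

open Classical in
/-- The parent of the node with identifier `i` in the canonical BFS tree. -/
noncomputable def parentId (S : Set Fact) (i : ℕ) : Option ℕ :=
  if i = rootId S then none
  else some (sInf {j | (factGraph S).Adj i j ∧
    (factGraph S).dist (rootId S) i = (factGraph S).dist (rootId S) j + 1})

-- Taking the least admissible parent makes the tree a function of `S` alone. Nodes with the same
-- facts thus agree on it, and each can find its children without further messages.
open Classical in
noncomputable def treeOutput (S : Set Fact) (x : LocalInput) : TreeOutput where
  parent := parentId S x.ownId
  children := x.neighborIds.filter fun j => parentId S j = some x.ownId

variable {V : Type} [Fintype V]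

/-- The choice of coins is immaterial: a fact does not contain them. -/
noncomputable def Network.fact (𝒩 : Network V) (v : V) : Fact :=
  (𝒩.input (fun _ => false) v).fact

def Network.embedding (𝒩 : Network V) : V ↪ ℕ := ⟨𝒩.ident, 𝒩.ident_injective⟩

variable {𝒩 : Network V}

theorem mem_neighborIds {c : ℕ → Bool} {v : V} {i : ℕ} :
    i ∈ (𝒩.input c v).neighborIds ↔ ∃ w, 𝒩.graph.Adj v w ∧ 𝒩.ident w = i := by
  simp [Network.input]

theorem factGraph_range : factGraph (Set.range 𝒩.fact) = 𝒩.graph.map 𝒩.embedding := by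
  have key : ∀ i j, (∃ f ∈ Set.range 𝒩.fact, f.id = i ∧ j ∈ f.nbrs) ↔
      ∃ v w, 𝒩.graph.Adj v w ∧ 𝒩.ident v = i ∧ 𝒩.ident w = j := by
    intro i j
    constructor
    · rintro ⟨_, ⟨v, rfl⟩, hi, hj⟩
      obtain ⟨w, hw, hwj⟩ := (mem_neighborIds (c := fun _ => false)).mp hj
      exact ⟨v, w, hw, hi, hwj⟩
    · rintro ⟨v, w, hvw, hi, hj⟩
      exact ⟨_, ⟨v, rfl⟩, hi, (mem_neighborIds (c := fun _ => false)).mpr ⟨w, hvw, hj⟩⟩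
  ext i j
  rw [factGraph, SimpleGraph.fromRel_adj, key, key, SimpleGraph.map_adj]
  constructor
  · rintro ⟨-, h | ⟨v, w, h, hv, hw⟩⟩
    · exact h
    · exact ⟨w, v, h.symm, hw, hv⟩
  · rintro ⟨v, w, h, rfl, rfl⟩
    exact ⟨𝒩.embedding.injective.ne h.ne, Or.inl ⟨v, w, h, rfl, rfl⟩⟩

theorem rootId_range : rootId (Set.range 𝒩.fact) = 𝒩.ident 𝒩.root := by
  have : {i | ∃ f ∈ Set.range 𝒩.fact, f.id = i ∧ f.isRoot} = {𝒩.ident 𝒩.root} := by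
    ext i
    constructor
    · rintro ⟨_, ⟨v, rfl⟩, rfl, hv⟩
      exact congrArg 𝒩.ident hv
    · rintro rfl
      exact ⟨_, ⟨𝒩.root, rfl⟩, rfl, rfl⟩
  rw [rootId, this, csInf_singleton]

/-- The parent identifiers computed from all facts are those of a parent function. -/
theorem exists_parent (hG : 𝒩.graph.Connected) {v : V} (hv : v ≠ 𝒩.root) :
    ∃ w, parentId (Set.range 𝒩.fact) (𝒩.ident v) = some (𝒩.ident w) ∧ 𝒩.graph.Adj v w ∧
      𝒩.graph.dist 𝒩.root v = 𝒩.graph.dist 𝒩.root w + 1 := by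
  have hset : {j | (factGraph (Set.range 𝒩.fact)).Adj (𝒩.ident v) j ∧
      (factGraph (Set.range 𝒩.fact)).dist (rootId (Set.range 𝒩.fact)) (𝒩.ident v) =
        (factGraph (Set.range 𝒩.fact)).dist (rootId (Set.range 𝒩.fact)) j + 1} =
      𝒩.ident '' {w | 𝒩.graph.Adj v w ∧
        𝒩.graph.dist 𝒩.root v = 𝒩.graph.dist 𝒩.root w + 1} := by
    have hd : ∀ u, (factGraph (Set.range 𝒩.fact)).dist (rootId (Set.range 𝒩.fact)) (𝒩.ident u) =
        𝒩.graph.dist 𝒩.root u := by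
      intro u
      rw [factGraph_range, rootId_range]
      exact dist_map_embedding hG 𝒩.embedding 𝒩.root u
    have ha : ∀ j, (factGraph (Set.range 𝒩.fact)).Adj (𝒩.ident v) j ↔
        ∃ w, 𝒩.graph.Adj v w ∧ 𝒩.ident w = j := by
      intro j
      rw [factGraph_range, SimpleGraph.map_adj]
      constructor
      · rintro ⟨a, b, hab, ha, hb⟩
        obtain rfl := 𝒩.ident_injective ha
        exact ⟨b, hab, hb⟩
      · rintro ⟨w, hw, hj⟩
        exact ⟨v, w, hw, rfl, hj⟩
    ext j
    simp only [Set.mem_ofPred_eq, ha, hd, Set.mem_image]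
    constructor
    · rintro ⟨⟨w, hw, rfl⟩, h⟩
      exact ⟨w, ⟨hw, by rwa [hd] at h⟩, rfl⟩
    · rintro ⟨w, ⟨hw, h⟩, rfl⟩
      exact ⟨⟨w, hw, rfl⟩, by rwa [hd]⟩
  obtain ⟨w₀, hw₀⟩ := exists_adj_dist_succ hG hv
  have hne : (𝒩.ident '' {w | 𝒩.graph.Adj v w ∧
      𝒩.graph.dist 𝒩.root v = 𝒩.graph.dist 𝒩.root w + 1}).Nonempty := ⟨_, w₀, hw₀, rfl⟩
  obtain ⟨w, hw, hwe⟩ := Nat.sInf_mem hne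
  refine ⟨w, ?_, hw⟩
  rw [parentId, if_neg (by rw [rootId_range]; exact 𝒩.ident_injective.ne hv), hset, hwe]

/-- The outputs computed from all facts describe a BFS tree. -/
theorem exists_tree_represents (hG : 𝒩.graph.Connected) (ω : V → ℕ → Bool) :
    ∃ T, IsBFSTree 𝒩.graph 𝒩.root T ∧
      Represents 𝒩 T fun v => treeOutput (Set.range 𝒩.fact) (𝒩.input (ω v) v) := by
  classical
  choose f hf using fun (v : V) (hv : v ≠ 𝒩.root) => exists_parent hG hv
  let par : V → V := fun v => if hv : v ≠ 𝒩.root then f v hv else v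
  have hparId : ∀ v, v ≠ 𝒩.root →
      parentId (Set.range 𝒩.fact) (𝒩.ident v) = some (𝒩.ident (par v)) := by
    intro v hv
    simp only [par, dif_pos hv]
    exact (hf v hv).1
  have hpar : ∀ v, v ≠ 𝒩.root → 𝒩.graph.Adj v (par v) ∧
      𝒩.graph.dist 𝒩.root v = 𝒩.graph.dist 𝒩.root (par v) + 1 := by
    intro v hv
    simp only [par, dif_pos hv]
    exact (hf v hv).2
  have hroot : parentId (Set.range 𝒩.fact) (𝒩.ident 𝒩.root) = none := by
    rw [parentId, if_pos rootId_range.symm]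
  have hT := isBFSTree_parentGraph hG hpar
  refine ⟨_, hT, hroot, fun v hv => ⟨par v, parentGraph_adj_par hpar hv, ?_, hparId v hv⟩, ?_⟩
  · rw [hT.2.2, hT.2.2]
    exact (hpar v hv).2
  · intro v i
    simp only [treeOutput, Finset.mem_filter, mem_neighborIds, hT.2.2]
    constructor
    · rintro ⟨⟨w, hw, rfl⟩, h⟩
      have hwr : w ≠ 𝒩.root := by
        rintro rfl
        rw [hroot] at h
        cases h
      obtain rfl : par w = v := by
        rw [hparId w hwr] at h
        exact 𝒩.ident_injective (Option.some.inj h)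
      exact ⟨w, (parentGraph_adj_par hpar hwr).symm, (hpar w hwr).2, rfl⟩
    · rintro ⟨w, hw, hd, rfl⟩
      refine ⟨⟨w, hT.1 hw, rfl⟩, ?_⟩
      obtain ⟨-, ⟨hv, rfl⟩ | ⟨hw', rfl⟩⟩ := (SimpleGraph.fromRel_adj _ _ _).mp hw
      · have := (hpar v hv).2
        omega
      · exact hparId w hw'

end Facts

/-! ### The distributed algorithm. -/

section AlgorithmDefinition

/-- The number of phases of the spanner construction. -/
def phases (N : ℕ) : ℕ := Nat.log 2 N + 1

/-- The number of rounds of a phase of the spanner construction. -/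
def phaseLength (N : ℕ) : ℕ := 2 * phases N + 1

/-- The number of rounds of the spanner construction. -/
def spannerTime (N : ℕ) : ℕ := phases N * phaseLength N

/-- The state of a node. During the spanner construction, `links` holds the spanner neighbors and
`heard` the nodes heard of in the current phase. Afterwards `level` is `0` until the node is
reached from the root, `1` until it has collected the facts of its descendants, `2` until it is
informed of all facts, and then `3`. The level last told to the neighbors is `announced`; `known`
holds the collected facts, and `done` the neighbors whose facts need not be awaited. -/
structure BFSState where
  input : LocalInput
  clock : ℕ
  links : Set ℕ
  heard : Set ℕ
  level : ℕ
  announced : ℕ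
  known : Set Fact
  done : Set ℕ

structure BFSMessage where
  heard : Set ℕ
  level : ℕ
  known : Set Fact

namespace BFSState

def message (s : BFSState) : BFSMessage := ⟨s.heard, s.level, s.known⟩

/-- At the start of a phase, `heard` is the ball of radius `2 * phases` in the spanner so far, so
the message goes to the greedy choice. After the construction a node speaks only when its level has
risen since its last announcement, which bounds the messages per link. -/
def Sends (s : BFSState) (i : ℕ) : Prop :=
  if s.clock < spannerTime s.input.idBound then
    if s.clock % phaseLength s.input.idBound = 0 then
      IsLeast {j | j ∈ s.input.neighborIds ∧ j ∉ s.heard} i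
    else i ∈ s.links
  else s.announced < s.level ∧ i ∈ s.links

/-- First round of a phase: links are established. -/
def link (s : BFSState) (M : Set (ℕ × BFSMessage)) : BFSState :=
  { s with
    clock := s.clock + 1
    links := s.links ∪
      ({i | IsLeast {j | j ∈ s.input.neighborIds ∧ j ∉ s.heard} i} ∪ {i | ∃ m, (i, m) ∈ M})
    heard := {s.input.ownId} }

/-- Other rounds of a phase: identifiers are flooded over the links. -/
def flood (s : BFSState) (M : Set (ℕ × BFSMessage)) : BFSState :=
  { s with
    clock := s.clock + 1
    heard := s.heard ∪ {j | ∃ p ∈ M, j ∈ p.2.heard} }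

/-- A sender heard while `announced` is still `0` was reached no later than the receiver could
announce itself, hence is not farther from the root and need not be awaited. A farther neighbor
counts only from level `2` on, when its message carries the facts of its descendants. -/
def newDone (s : BFSState) (M : Set (ℕ × BFSMessage)) : Set ℕ :=
  s.done ∪ {i | ∃ m, (i, m) ∈ M ∧ (s.announced = 0 ∨ 2 ≤ m.level)}

-- Level `3` is inherited from an informed neighbor or created at the root once all its links are
-- done, which starts the broadcast. Other nodes with all links done stop at `2`, and a node not yet
-- reached by the wave stays at `0`.
open Classical in
noncomputable def newLevel (s : BFSState) (M : Set (ℕ × BFSMessage)) : ℕ :=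
  if ∃ p ∈ M, p.2.level = 3 then 3
  else if s.level = 0 ∧ M = ∅ then 0
  else if s.links ⊆ s.newDone M then (if s.input.isRoot then 3 else 2)
  else 1

/-- Rounds after the spanner construction: the facts are gathered at the root and spread. -/
noncomputable def collect (s : BFSState) (M : Set (ℕ × BFSMessage)) : BFSState :=
  { s with
    clock := s.clock + 1
    level := max s.level (s.newLevel M)
    announced := s.level
    known := s.known ∪ {f | ∃ p ∈ M, f ∈ p.2.known}
    done := s.newDone M }

noncomputable def receive (s : BFSState) (M : Set (ℕ × BFSMessage)) : BFSState :=
  if s.clock < spannerTime s.input.idBound then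
    if s.clock % phaseLength s.input.idBound = 0 then s.link M else s.flood M
  else s.collect M

theorem sends_of_link {s : BFSState} {i : ℕ} (h : s.clock < spannerTime s.input.idBound)
    (h' : s.clock % phaseLength s.input.idBound = 0) :
    s.Sends i ↔ IsLeast {j | j ∈ s.input.neighborIds ∧ j ∉ s.heard} i := by
  rw [Sends, if_pos h, if_pos h']

theorem sends_of_flood {s : BFSState} {i : ℕ} (h : s.clock < spannerTime s.input.idBound)
    (h' : s.clock % phaseLength s.input.idBound ≠ 0) : s.Sends i ↔ i ∈ s.links := by
  rw [Sends, if_pos h, if_neg h']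

theorem sends_of_collect {s : BFSState} {i : ℕ} (h : spannerTime s.input.idBound ≤ s.clock) :
    s.Sends i ↔ s.announced < s.level ∧ i ∈ s.links := by
  rw [Sends, if_neg h.not_gt]

theorem receive_of_link {s : BFSState} {M : Set (ℕ × BFSMessage)}
    (h : s.clock < spannerTime s.input.idBound)
    (h' : s.clock % phaseLength s.input.idBound = 0) : s.receive M = s.link M := by
  rw [receive, if_pos h, if_pos h']

theorem receive_of_flood {s : BFSState} {M : Set (ℕ × BFSMessage)}
    (h : s.clock < spannerTime s.input.idBound)
    (h' : s.clock % phaseLength s.input.idBound ≠ 0) : s.receive M = s.flood M := by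
  rw [receive, if_pos h, if_neg h']

theorem receive_of_collect {s : BFSState} {M : Set (ℕ × BFSMessage)}
    (h : spannerTime s.input.idBound ≤ s.clock) : s.receive M = s.collect M := by
  rw [receive, if_neg h.not_gt]

open Classical in
/-- The state of a node at time `t` of the spanner construction. -/
noncomputable def building (x : LocalInput) (t : ℕ) (links heard : Set ℕ) : BFSState where
  input := x
  clock := t
  links := links
  heard := heard
  level := if x.isRoot then 1 else 0
  announced := 0
  known := {x.fact}
  done := ∅

end BFSState

open Classical in
/-- Greedy spanner construction, followed by gathering the whole network at the root, which then
spreads it over the spanner. The algorithm is deterministic: it ignores the random bits and always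
succeeds. -/
noncomputable def bfsAlgorithm : Algorithm TreeOutput where
  State := BFSState
  Msg := BFSMessage
  init x := BFSState.building x 0 ∅ {x.ownId}
  send s i := if s.Sends i then some s.message else none
  receive := BFSState.receive
  output s := if s.announced = 3 then some (treeOutput s.known s.input) else none

end AlgorithmDefinition

/-! ### A single round of the algorithm. -/

section Rounds

variable {V : Type} {𝒩 : Network V} {σ : V → BFSState}

theorem message_eq_some {s : BFSState} {i : ℕ} {m : BFSMessage} :
    bfsAlgorithm.message s i = some m ↔ s.announced ≠ 3 ∧ s.Sends i ∧ s.message = m := by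
  by_cases h : s.announced = 3 <;> by_cases h' : s.Sends i <;>
    simp [Algorithm.message, bfsAlgorithm, h, h']

theorem message_ne_none {s : BFSState} {i : ℕ} :
    bfsAlgorithm.message s i ≠ none ↔ s.announced ≠ 3 ∧ s.Sends i := by
  rw [Option.ne_none_iff_exists']
  constructor
  · rintro ⟨m, hm⟩
    exact ⟨(message_eq_some.mp hm).1, (message_eq_some.mp hm).2.1⟩
  · rintro ⟨h, h'⟩
    exact ⟨_, message_eq_some.mpr ⟨h, h', rfl⟩⟩

/-- The messages that reach `v` in a round that starts in the configuration `σ`. -/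
def bfsInbox (𝒩 : Network V) (σ : V → BFSState) (v : V) : Set (ℕ × BFSMessage) :=
  {p | ∃ u, 𝒩.graph.Adj u v ∧ p.1 = 𝒩.ident u ∧
    (σ u).announced ≠ 3 ∧ (σ u).Sends (𝒩.ident v) ∧ (σ u).message = p.2}

theorem bfsInbox_eq (v : V) : bfsAlgorithm.inbox 𝒩 σ v = bfsInbox 𝒩 σ v := by
  ext p
  simp only [Algorithm.inbox, bfsInbox, Set.mem_ofPred_eq]
  exact exists_congr fun u => and_congr_right fun _ => and_congr_right fun _ => message_eq_some

variable [Fintype V] {ω : V → ℕ → Bool}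

/-- The configuration of the algorithm after `t` rounds. -/
noncomputable def bfsConfig (𝒩 : Network V) (ω : V → ℕ → Bool) (t : ℕ) : V → BFSState :=
  bfsAlgorithm.config 𝒩 ω t

theorem bfsConfig_zero (v : V) :
    bfsConfig 𝒩 ω 0 v = BFSState.building (𝒩.input (ω v) v) 0 ∅ {𝒩.ident v} := rfl

theorem bfsConfig_succ_of_active {t : ℕ} {v : V} (h : (bfsConfig 𝒩 ω t v).announced ≠ 3) :
    bfsConfig 𝒩 ω (t + 1) v =
      (bfsConfig 𝒩 ω t v).receive (bfsInbox 𝒩 (bfsConfig 𝒩 ω t) v) := by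
  have hout : bfsAlgorithm.output (bfsAlgorithm.config 𝒩 ω t v) = none := if_neg h
  rw [← bfsInbox_eq]
  simp only [bfsConfig, Algorithm.config, Algorithm.step, hout]
  rfl

theorem bfsConfig_succ_of_halted {t : ℕ} {v : V} (h : (bfsConfig 𝒩 ω t v).announced = 3) :
    bfsConfig 𝒩 ω (t + 1) v = bfsConfig 𝒩 ω t v := by
  have hout : bfsAlgorithm.output (bfsAlgorithm.config 𝒩 ω t v) = some _ := if_pos h
  simp only [bfsConfig, Algorithm.config, Algorithm.step, hout]
  rfl

theorem roundMessages_eq (t : ℕ) :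
    bfsAlgorithm.roundMessages 𝒩 (bfsAlgorithm.config 𝒩 ω t) =
      Set.ncard {p : V × V | 𝒩.graph.Adj p.1 p.2 ∧
        (bfsConfig 𝒩 ω t p.1).announced ≠ 3 ∧
        (bfsConfig 𝒩 ω t p.1).Sends (𝒩.ident p.2)} := by
  refine congrArg Set.ncard (Set.ext fun p => ?_)
  exact and_congr_right fun _ => message_ne_none

end Rounds

/-! ### The first stage of the algorithm computes the greedy spanner. -/

section SpannerConstruction

variable {V : Type}

def Network.linkIds (𝒩 : Network V) (H : SimpleGraph V) (v : V) : Set ℕ :=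
  𝒩.ident '' {w | H.Adj v w}

def Network.ballIds (𝒩 : Network V) (H : SimpleGraph V) (k : ℕ) (v : V) : Set ℕ :=
  𝒩.ident '' {w | Within H k v w}

/-- The spanner after `i` phases. -/
def Network.spanner (𝒩 : Network V) (i : ℕ) : SimpleGraph V :=
  KT1Local.spanner 𝒩.graph 𝒩.ident (2 * phases 𝒩.idBound) i

variable {𝒩 : Network V}

theorem ident_mem_linkIds {H : SimpleGraph V} {v w : V} :
    𝒩.ident w ∈ 𝒩.linkIds H v ↔ H.Adj v w := by
  rw [Network.linkIds, 𝒩.ident_injective.mem_set_image]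
  rfl

theorem ident_mem_ballIds {H : SimpleGraph V} {k : ℕ} {v w : V} :
    𝒩.ident w ∈ 𝒩.ballIds H k v ↔ Within H k v w := by
  rw [Network.ballIds, 𝒩.ident_injective.mem_set_image]
  rfl

theorem ballIds_of_forall_eq {H : SimpleGraph V} {k : ℕ} {v : V}
    (h : ∀ w, Within H k v w ↔ v = w) : 𝒩.ballIds H k v = {𝒩.ident v} := by
  have : {w | Within H k v w} = {v} := by
    ext w
    exact (h w).trans eq_comm
  rw [Network.ballIds, this, Set.image_singleton]

theorem network_spanner_le (i : ℕ) : 𝒩.spanner i ≤ 𝒩.graph :=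
  spanner_le 𝒩.ident_injective i

theorem time_lt_spannerTime {i o : ℕ} (hi : i < phases 𝒩.idBound)
    (ho : o < phaseLength 𝒩.idBound) :
    i * phaseLength 𝒩.idBound + o < spannerTime 𝒩.idBound :=
  calc i * phaseLength 𝒩.idBound + o < (i + 1) * phaseLength 𝒩.idBound := by
        rw [add_mul, one_mul]
        omega
    _ ≤ spannerTime 𝒩.idBound := Nat.mul_le_mul_right _ hi

variable [Fintype V]

theorem isLeast_fresh_iff {H : SimpleGraph V} {k : ℕ} {c : ℕ → Bool} {u v : V} :
    IsLeast {j | j ∈ (𝒩.input c u).neighborIds ∧ j ∉ 𝒩.ballIds H k u} (𝒩.ident v) ↔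
      LinkRel 𝒩.graph 𝒩.ident k H u v := by
  have : {j | j ∈ (𝒩.input c u).neighborIds ∧ j ∉ 𝒩.ballIds H k u} =
      𝒩.ident '' {w | 𝒩.graph.Adj u w ∧ ¬ Within H k u w} := by
    ext j
    constructor
    · rintro ⟨hj, hj'⟩
      obtain ⟨w, hw, rfl⟩ := mem_neighborIds.mp hj
      exact ⟨w, ⟨hw, fun h => hj' (ident_mem_ballIds.mpr h)⟩, rfl⟩
    · rintro ⟨w, ⟨hw, hw'⟩, rfl⟩
      exact ⟨mem_neighborIds.mpr ⟨w, hw, rfl⟩, fun h => hw' (ident_mem_ballIds.mp h)⟩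
  rw [this, LinkRel]

/-- The configuration of the spanner construction at time `t`, with links `H`, when every node has
heard of the nodes within distance `k`. -/
noncomputable def Network.buildingConfig (𝒩 : Network V) (ω : V → ℕ → Bool) (t : ℕ)
    (H : SimpleGraph V) (k : ℕ) (v : V) : BFSState :=
  BFSState.building (𝒩.input (ω v) v) t (𝒩.linkIds H v) (𝒩.ballIds H k v)

variable {ω : V → ℕ → Bool}

theorem sends_buildingConfig_link {t k : ℕ} {H : SimpleGraph V} {u v : V}
    (ht : t < spannerTime 𝒩.idBound) (hm : t % phaseLength 𝒩.idBound = 0) :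
    (𝒩.buildingConfig ω t H k u).Sends (𝒩.ident v) ↔ LinkRel 𝒩.graph 𝒩.ident k H u v := by
  rw [← isLeast_fresh_iff (c := ω u)]
  exact BFSState.sends_of_link (s := 𝒩.buildingConfig ω t H k u) ht hm

theorem sends_buildingConfig_flood {t k : ℕ} {H : SimpleGraph V} {u v : V}
    (ht : t < spannerTime 𝒩.idBound) (hm : t % phaseLength 𝒩.idBound ≠ 0) :
    (𝒩.buildingConfig ω t H k u).Sends (𝒩.ident v) ↔ H.Adj u v := by
  rw [← ident_mem_linkIds (𝒩 := 𝒩)]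
  exact BFSState.sends_of_flood (s := 𝒩.buildingConfig ω t H k u) ht hm

/-- The chooser adds the link on its own; the other end adds it because a message arrives, whatever
its content. Resetting `heard` to the own identifier restarts flooding at radius `0`. -/
theorem bfsConfig_succ_link {t i : ℕ} (ht : t < spannerTime 𝒩.idBound)
    (hm : t % phaseLength 𝒩.idBound = 0)
    (h : bfsConfig 𝒩 ω t =
      𝒩.buildingConfig ω t (𝒩.spanner i) (2 * phases 𝒩.idBound)) :
    bfsConfig 𝒩 ω (t + 1) = 𝒩.buildingConfig ω (t + 1) (𝒩.spanner (i + 1)) 0 := by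
  funext v
  have hadj : ∀ {w : V}, (𝒩.spanner (i + 1)).Adj v w ↔ _ :=
    spanner_succ_adj 𝒩.ident_injective
  rw [bfsConfig_succ_of_active (by rw [h]; exact Nat.zero_ne_add_one 2), h,
    BFSState.receive_of_link (by exact ht) (by exact hm)]
  have hlinks : 𝒩.linkIds (𝒩.spanner i) v ∪
      ({j | IsLeast {j | j ∈ (𝒩.input (ω v) v).neighborIds ∧
        j ∉ 𝒩.ballIds (𝒩.spanner i) (2 * phases 𝒩.idBound) v} j} ∪
      {j | ∃ m, (j, m) ∈ bfsInbox 𝒩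
        (𝒩.buildingConfig ω t (𝒩.spanner i) (2 * phases 𝒩.idBound)) v}) =
      𝒩.linkIds (𝒩.spanner (i + 1)) v := by
    ext j
    constructor
    · rintro (⟨w, hw, rfl⟩ | hj | ⟨m, hm'⟩)
      · exact ident_mem_linkIds.mpr (hadj.mpr (Or.inl hw))
      · obtain ⟨w, -, rfl⟩ := mem_neighborIds.mp hj.1.1
        exact ident_mem_linkIds.mpr (hadj.mpr (Or.inr (Or.inl (isLeast_fresh_iff.mp hj))))
      · obtain ⟨u, -, rfl, -, hu, -⟩ := hm'
        exact ident_mem_linkIds.mpr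
          (hadj.mpr (Or.inr (Or.inr ((sends_buildingConfig_link ht hm).mp hu))))
    · rintro ⟨w, hw, rfl⟩
      rcases hadj.mp hw with h | h | h
      · exact Or.inl (ident_mem_linkIds.mpr h)
      · exact Or.inr (Or.inl (isLeast_fresh_iff.mpr h))
      · exact Or.inr (Or.inr ⟨_, ⟨w, (h.adj 𝒩.ident_injective).1, rfl,
          Nat.zero_ne_add_one 2,
          (sends_buildingConfig_link ht hm).mpr h, rfl⟩⟩)
  simp only [BFSState.link, Network.buildingConfig, BFSState.building] at hlinks ⊢
  rw [hlinks, ballIds_of_forall_eq fun w => within_zero]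
  rfl

theorem bfsConfig_succ_flood {t k : ℕ} {H : SimpleGraph V} (hH : H ≤ 𝒩.graph)
    (ht : t < spannerTime 𝒩.idBound) (hm : t % phaseLength 𝒩.idBound ≠ 0)
    (h : bfsConfig 𝒩 ω t = 𝒩.buildingConfig ω t H k) :
    bfsConfig 𝒩 ω (t + 1) = 𝒩.buildingConfig ω (t + 1) H (k + 1) := by
  funext v
  rw [bfsConfig_succ_of_active (by rw [h]; exact Nat.zero_ne_add_one 2), h,
    BFSState.receive_of_flood (by exact ht) (by exact hm)]
  have hheard : 𝒩.ballIds H k v ∪ {j | ∃ p ∈ bfsInbox 𝒩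
      (𝒩.buildingConfig ω t H k) v, j ∈ p.2.heard} = 𝒩.ballIds H (k + 1) v := by
    ext j
    constructor
    · rintro (⟨w, hw, rfl⟩ | ⟨⟨i, m⟩, hp, hj⟩)
      · exact ident_mem_ballIds.mpr (within_succ.mpr (Or.inl hw))
      · obtain ⟨u, -, rfl, -, hu, rfl⟩ := hp
        obtain ⟨w, hw, rfl⟩ := hj
        exact ident_mem_ballIds.mpr
          (within_succ.mpr (Or.inr ⟨u, (sends_buildingConfig_flood ht hm).mp hu, hw⟩))
    · rintro ⟨w, hw, rfl⟩
      rcases within_succ.mp hw with h | ⟨u, hu, h⟩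
      · exact Or.inl (ident_mem_ballIds.mpr h)
      · exact Or.inr ⟨(𝒩.ident u, (𝒩.buildingConfig ω t H k u).message), ⟨u, hH hu, rfl,
          Nat.zero_ne_add_one 2,
          (sends_buildingConfig_flood ht hm).mpr hu, rfl⟩, ident_mem_ballIds.mpr h⟩
  simp only [BFSState.flood, Network.buildingConfig, BFSState.building] at hheard ⊢
  rw [hheard]

/-- The offset is `k + 1` because the linking round precedes the `k` rounds of flooding. -/
theorem config_in_phase {i : ℕ} (hi : i < phases 𝒩.idBound)
    (h : bfsConfig 𝒩 ω (i * phaseLength 𝒩.idBound) =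
      𝒩.buildingConfig ω (i * phaseLength 𝒩.idBound) (𝒩.spanner i) (2 * phases 𝒩.idBound))
    {k : ℕ} (hk : k ≤ 2 * phases 𝒩.idBound) :
    bfsConfig 𝒩 ω (i * phaseLength 𝒩.idBound + (k + 1)) =
      𝒩.buildingConfig ω (i * phaseLength 𝒩.idBound + (k + 1)) (𝒩.spanner (i + 1)) k := by
  induction k with
  | zero =>
    exact bfsConfig_succ_link (time_lt_spannerTime hi (Nat.succ_pos _)) (Nat.mul_mod_left _ _) h
  | succ k ih =>
    have hlt : k + 1 < phaseLength 𝒩.idBound := by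
      unfold phaseLength
      omega
    refine bfsConfig_succ_flood (t := i * phaseLength 𝒩.idBound + (k + 1))
      (network_spanner_le _) (time_lt_spannerTime hi hlt) ?_
      (ih (by omega))
    rw [Nat.mul_add_mod_self_right, Nat.mod_eq_of_lt hlt]
    exact Nat.succ_ne_zero k

theorem config_phase_start {i : ℕ} (hi : i ≤ phases 𝒩.idBound) :
    bfsConfig 𝒩 ω (i * phaseLength 𝒩.idBound) =
      𝒩.buildingConfig ω (i * phaseLength 𝒩.idBound) (𝒩.spanner i)
        (2 * phases 𝒩.idBound) := by
  induction i with
  | zero =>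
    funext v
    have h₁ : 𝒩.linkIds (𝒩.spanner 0) v = ∅ := by
      simp [Network.linkIds, Network.spanner, spanner]
    have h₂ : 𝒩.ballIds (𝒩.spanner 0) (2 * phases 𝒩.idBound) v = {𝒩.ident v} :=
      ballIds_of_forall_eq fun w => within_bot
    rw [zero_mul, Network.buildingConfig, h₁, h₂, bfsConfig_zero]
  | succ i ih =>
    have := config_in_phase (ω := ω) hi (ih (by omega)) le_rfl
    rw [add_mul, one_mul]
    exact this

theorem config_spannerTime :
    bfsConfig 𝒩 ω (spannerTime 𝒩.idBound) =
      𝒩.buildingConfig ω (spannerTime 𝒩.idBound) (𝒩.spanner (phases 𝒩.idBound))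
        (2 * phases 𝒩.idBound) :=
  config_phase_start le_rfl

/-- A message of a linking round creates the link it travels on, and a flooding message uses an
existing link. Links are never removed, so all of them lie in the final spanner. -/
theorem roundMessages_le_of_lt_spannerTime {t : ℕ} (ht : t < spannerTime 𝒩.idBound) :
    bfsAlgorithm.roundMessages 𝒩 (bfsAlgorithm.config 𝒩 ω t) ≤
      Set.ncard {p : V × V | (𝒩.spanner (phases 𝒩.idBound)).Adj p.1 p.2} := by
  have hP : 0 < phaseLength 𝒩.idBound := Nat.succ_pos _
  have hi : t / phaseLength 𝒩.idBound < phases 𝒩.idBound := Nat.div_lt_of_lt_mul (by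
    rw [mul_comm]
    exact ht)
  have hmod := Nat.mod_lt t hP
  have hmono : 𝒩.spanner (t / phaseLength 𝒩.idBound + 1) ≤ 𝒩.spanner (phases 𝒩.idBound) :=
    spanner_mono hi
  have hdiv : t / phaseLength 𝒩.idBound * phaseLength 𝒩.idBound +
      t % phaseLength 𝒩.idBound = t := by
    rw [mul_comm]
    exact Nat.div_add_mod t _
  have hstart := config_phase_start (ω := ω) hi.le
  rw [roundMessages_eq]
  refine Set.ncard_le_ncard ?_
  rintro ⟨u, v⟩ ⟨-, -, h⟩
  refine hmono ?_
  rcases Nat.eq_zero_or_eq_succ_pred (t % phaseLength 𝒩.idBound) with h0 | hk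
  · rw [h0, add_zero] at hdiv
    rw [hdiv] at hstart
    rw [hstart] at h
    exact (spanner_succ_adj 𝒩.ident_injective).mpr
      (Or.inr (Or.inl ((sends_buildingConfig_link ht h0).mp h)))
  · have hin := config_in_phase (ω := ω) hi hstart
      (k := (t % phaseLength 𝒩.idBound).pred) (by unfold phaseLength at hmod hk ⊢; omega)
    rw [← Nat.succ_eq_add_one, ← hk, hdiv] at hin
    rw [hin] at h
    exact (sends_buildingConfig_flood ht (by omega)).mp h

end SpannerConstruction

/-! ### The second stage: levels, announcements and the wave from the root. -/

section Collecting

namespace BFSState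

variable {s : BFSState} {M : Set (ℕ × BFSMessage)}

theorem newLevel_le : s.newLevel M ≤ 3 := by
  unfold newLevel
  split_ifs <;> omega

theorem newLevel_eq_zero : s.newLevel M = 0 ↔ s.level = 0 ∧ M = ∅ := by
  unfold newLevel
  split_ifs with h₁ h₂
  · obtain ⟨p, hp, -⟩ := h₁
    simp [Set.nonempty_iff_ne_empty.mp ⟨p, hp⟩]
  all_goals simp [h₂]

theorem newLevel_eq_three_of_mem (h : ∃ p ∈ M, p.2.level = 3) : s.newLevel M = 3 := by
  rw [newLevel, if_pos h]

theorem links_subset_of_two_le_newLevel (h : 2 ≤ s.newLevel M) :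
    (∃ p ∈ M, p.2.level = 3) ∨ s.links ⊆ s.newDone M := by
  unfold newLevel at h
  split_ifs at h with h₁ h₂ h₃
  · exact Or.inl h₁
  · omega
  · exact Or.inr h₃
  · exact Or.inr h₃
  · omega

theorem isRoot_of_newLevel_eq_three (h : s.newLevel M = 3) :
    (∃ p ∈ M, p.2.level = 3) ∨ s.input.isRoot := by
  unfold newLevel at h
  split_ifs at h with h₁ h₂ h₃ h₄
  · exact Or.inl h₁
  · exact Or.inr h₄
  all_goals omega

theorem two_le_newLevel (h : s.newLevel M ≠ 0) (hd : s.links ⊆ s.newDone M) :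
    2 ≤ s.newLevel M := by
  have h₂ : ¬ (s.level = 0 ∧ M = ∅) := fun h' => h (newLevel_eq_zero.mpr h')
  unfold newLevel
  rw [if_neg h₂, if_pos hd]
  split_ifs <;> omega

theorem newLevel_eq_three_of_isRoot (h : s.newLevel M ≠ 0) (hd : s.links ⊆ s.newDone M)
    (hr : s.input.isRoot) : s.newLevel M = 3 := by
  have h₂ : ¬ (s.level = 0 ∧ M = ∅) := fun h' => h (newLevel_eq_zero.mpr h')
  unfold newLevel
  rw [if_neg h₂, if_pos hd, if_pos hr, ite_self]

end BFSState

variable {V : Type} [Fintype V] {𝒩 : Network V} {ω : V → ℕ → Bool}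

/-- The configuration `s` rounds after the end of the spanner construction. -/
noncomputable def collectConfig (𝒩 : Network V) (ω : V → ℕ → Bool) (s : ℕ) : V → BFSState :=
  bfsConfig 𝒩 ω (spannerTime 𝒩.idBound + s)

def Network.finalSpanner (𝒩 : Network V) : SimpleGraph V := 𝒩.spanner (phases 𝒩.idBound)

theorem collectConfig_zero : collectConfig 𝒩 ω 0 =
    𝒩.buildingConfig ω (spannerTime 𝒩.idBound) 𝒩.finalSpanner (2 * phases 𝒩.idBound) :=
  config_spannerTime

theorem collectConfig_static (s : ℕ) (v : V) :
    (collectConfig 𝒩 ω s v).input = 𝒩.input (ω v) v ∧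
      (collectConfig 𝒩 ω s v).links = 𝒩.linkIds 𝒩.finalSpanner v ∧
      spannerTime 𝒩.idBound ≤ (collectConfig 𝒩 ω s v).clock := by
  induction s with
  | zero =>
    rw [collectConfig_zero]
    exact ⟨rfl, rfl, le_rfl⟩
  | succ s ih =>
    by_cases h : (collectConfig 𝒩 ω s v).announced = 3
    · have : collectConfig 𝒩 ω (s + 1) v = collectConfig 𝒩 ω s v := bfsConfig_succ_of_halted h
      rwa [this]
    · have : collectConfig 𝒩 ω (s + 1) v = _ := bfsConfig_succ_of_active h
      rw [this, BFSState.receive_of_collect]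
      · exact ⟨ih.1, ih.2.1, ih.2.2.trans (Nat.le_succ _)⟩
      · change spannerTime (collectConfig 𝒩 ω s v).input.idBound ≤ _
        rw [ih.1]
        exact ih.2.2

theorem collectConfig_succ_of_halted {s : ℕ} {v : V}
    (h : (collectConfig 𝒩 ω s v).announced = 3) :
    collectConfig 𝒩 ω (s + 1) v = collectConfig 𝒩 ω s v :=
  bfsConfig_succ_of_halted h

theorem spannerTime_le_clock (s : ℕ) (v : V) :
    spannerTime (collectConfig 𝒩 ω s v).input.idBound ≤ (collectConfig 𝒩 ω s v).clock := by
  obtain ⟨h₁, -, h₂⟩ := collectConfig_static (𝒩 := 𝒩) (ω := ω) s v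
  rw [h₁]
  exact h₂

theorem collectConfig_succ_of_active {s : ℕ} {v : V}
    (h : (collectConfig 𝒩 ω s v).announced ≠ 3) :
    collectConfig 𝒩 ω (s + 1) v =
      (collectConfig 𝒩 ω s v).collect (bfsInbox 𝒩 (collectConfig 𝒩 ω s) v) := by
  rw [← BFSState.receive_of_collect (spannerTime_le_clock s v)]
  exact bfsConfig_succ_of_active h

theorem level_announced_bounds (s : ℕ) (v : V) :
    (collectConfig 𝒩 ω s v).announced ≤ (collectConfig 𝒩 ω s v).level ∧
      (collectConfig 𝒩 ω s v).level ≤ 3 := by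
  induction s with
  | zero =>
    rw [collectConfig_zero]
    simp only [Network.buildingConfig, BFSState.building]
    split_ifs <;> simp
  | succ s ih =>
    by_cases h : (collectConfig 𝒩 ω s v).announced = 3
    · rwa [collectConfig_succ_of_halted h]
    · rw [collectConfig_succ_of_active h]
      exact ⟨le_max_left _ _, max_le ih.2 BFSState.newLevel_le⟩

theorem announced_zero (v : V) : (collectConfig 𝒩 ω 0 v).announced = 0 := by
  rw [collectConfig_zero]
  rfl

/-- The announced level lags the level by one round. This also holds for halted nodes, whose two
levels are both `3`. -/
theorem announced_succ (s : ℕ) (v : V) :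
    (collectConfig 𝒩 ω (s + 1) v).announced = (collectConfig 𝒩 ω s v).level := by
  by_cases h : (collectConfig 𝒩 ω s v).announced = 3
  · rw [collectConfig_succ_of_halted h]
    have := level_announced_bounds (𝒩 := 𝒩) (ω := ω) s v
    omega
  · rw [collectConfig_succ_of_active h]
    rfl

theorem level_mono (v : V) : Monotone fun s => (collectConfig 𝒩 ω s v).level := by
  refine monotone_nat_of_le_succ fun s => ?_
  rw [← announced_succ]
  exact (level_announced_bounds (s + 1) v).1

theorem announced_mono (v : V) : Monotone fun s => (collectConfig 𝒩 ω s v).announced := by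
  refine monotone_nat_of_le_succ fun s => ?_
  rw [announced_succ]
  exact (level_announced_bounds s v).1

theorem known_mono (v : V) : Monotone fun s => (collectConfig 𝒩 ω s v).known := by
  refine monotone_nat_of_le_succ fun s => ?_
  by_cases h : (collectConfig 𝒩 ω s v).announced = 3
  · rw [collectConfig_succ_of_halted h]
  · rw [collectConfig_succ_of_active h]
    exact Set.subset_union_left

theorem done_mono (v : V) : Monotone fun s => (collectConfig 𝒩 ω s v).done := by
  refine monotone_nat_of_le_succ fun s => ?_
  by_cases h : (collectConfig 𝒩 ω s v).announced = 3
  · rw [collectConfig_succ_of_halted h]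
  · rw [collectConfig_succ_of_active h]
    exact Set.subset_union_left

theorem collect_sends_iff {s : ℕ} {u v : V} :
    (collectConfig 𝒩 ω s u).Sends (𝒩.ident v) ↔
      (collectConfig 𝒩 ω s u).announced < (collectConfig 𝒩 ω s u).level ∧
        𝒩.finalSpanner.Adj u v := by
  rw [BFSState.sends_of_collect (spannerTime_le_clock s u), (collectConfig_static s u).2.1,
    ident_mem_linkIds]

/-- The messages which reach `v` come from the spanner neighbors that have news. -/
theorem mem_collect_inbox {s : ℕ} {v : V} {p : ℕ × BFSMessage} :
    p ∈ bfsInbox 𝒩 (collectConfig 𝒩 ω s) v ↔ ∃ u, 𝒩.finalSpanner.Adj u v ∧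
      (collectConfig 𝒩 ω s u).announced < (collectConfig 𝒩 ω s u).level ∧
      p = (𝒩.ident u, (collectConfig 𝒩 ω s u).message) := by
  constructor
  · rintro ⟨u, -, h₁, -, h₂, h₃⟩
    obtain ⟨h₄, h₅⟩ := collect_sends_iff.mp h₂
    exact ⟨u, h₅, h₄, Prod.ext h₁ h₃.symm⟩
  · rintro ⟨u, h₁, h₂, rfl⟩
    have := (level_announced_bounds (𝒩 := 𝒩) (ω := ω) s u).2
    exact ⟨u, network_spanner_le _ h₁, rfl, by omega, collect_sends_iff.mpr ⟨h₂, h₁⟩, rfl⟩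

theorem level_succ_of_active {s : ℕ} {v : V} (h : (collectConfig 𝒩 ω s v).announced ≠ 3) :
    (collectConfig 𝒩 ω (s + 1) v).level = max (collectConfig 𝒩 ω s v).level
      ((collectConfig 𝒩 ω s v).newLevel (bfsInbox 𝒩 (collectConfig 𝒩 ω s) v)) := by
  rw [collectConfig_succ_of_active h]
  rfl

/-- A level that a node has reached was sent to its spanner neighbors, or is being sent. -/
theorem exists_announcement {s l : ℕ} {v : V} (hl : 0 < l)
    (h : l ≤ (collectConfig 𝒩 ω s v).level) :
    ∃ τ ≤ s, (collectConfig 𝒩 ω τ v).announced < l ∧ l ≤ (collectConfig 𝒩 ω τ v).level := by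
  induction s with
  | zero => exact ⟨0, le_rfl, by rwa [announced_zero], h⟩
  | succ s ih =>
    by_cases h' : (collectConfig 𝒩 ω (s + 1) v).announced < l
    · exact ⟨s + 1, le_rfl, h', h⟩
    · rw [announced_succ, not_lt] at h'
      obtain ⟨τ, hτ, hτ'⟩ := ih h'
      exact ⟨τ, hτ.trans (Nat.le_succ s), hτ'⟩

theorem mem_done_succ {s : ℕ} {u v : V} (hv : (collectConfig 𝒩 ω s v).announced ≠ 3)
    (huv : 𝒩.finalSpanner.Adj u v)
    (hu : (collectConfig 𝒩 ω s u).announced < (collectConfig 𝒩 ω s u).level)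
    (h : (collectConfig 𝒩 ω s v).announced = 0 ∨ 2 ≤ (collectConfig 𝒩 ω s u).level) :
    𝒩.ident u ∈ (collectConfig 𝒩 ω (s + 1) v).done := by
  rw [collectConfig_succ_of_active hv]
  exact Or.inr ⟨_, mem_collect_inbox.mpr ⟨u, huv, hu, rfl⟩, h⟩

theorem one_le_level_succ {s : ℕ} {u v : V} (huv : 𝒩.finalSpanner.Adj u v)
    (hu : (collectConfig 𝒩 ω s u).announced < (collectConfig 𝒩 ω s u).level) :
    1 ≤ (collectConfig 𝒩 ω (s + 1) v).level := by
  by_cases h : (collectConfig 𝒩 ω s v).announced = 3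
  · rw [collectConfig_succ_of_halted h]
    have := (level_announced_bounds (𝒩 := 𝒩) (ω := ω) s v).1
    omega
  · rw [level_succ_of_active h]
    refine le_max_of_le_right (Nat.one_le_iff_ne_zero.mpr fun h0 => ?_)
    have hmem := mem_collect_inbox.mpr ⟨u, huv, hu, rfl⟩
    rw [(BFSState.newLevel_eq_zero.mp h0).2] at hmem
    exact hmem

section Reach

variable (hH : 𝒩.finalSpanner.Connected)
include hH

/-- The wave advances by exactly one layer per round: a node at level `0` rises only on receiving a
message, and every newly reached node announces itself at once. -/
theorem one_le_level_iff (s : ℕ) (v : V) :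
    1 ≤ (collectConfig 𝒩 ω s v).level ↔ 𝒩.finalSpanner.dist 𝒩.root v ≤ s := by
  induction s generalizing v with
  | zero =>
    rw [collectConfig_zero, Nat.le_zero, hH.dist_eq_zero_iff]
    by_cases h : v = 𝒩.root
    · simp [Network.buildingConfig, BFSState.building, Network.input, h]
    · simp [Network.buildingConfig, BFSState.building, Network.input, h, Ne.symm h]
  | succ s ih =>
    constructor
    · intro h
      by_cases h' : 1 ≤ (collectConfig 𝒩 ω s v).level
      · exact ((ih v).mp h').trans (Nat.le_succ s)
      · have hact : (collectConfig 𝒩 ω s v).announced ≠ 3 := by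
          have := (level_announced_bounds (𝒩 := 𝒩) (ω := ω) s v).1
          omega
        rw [level_succ_of_active hact] at h
        have hne : bfsInbox 𝒩 (collectConfig 𝒩 ω s) v ≠ ∅ := by
          intro h0
          have := (BFSState.newLevel_eq_zero (s := collectConfig 𝒩 ω s v)).mpr ⟨by omega, h0⟩
          omega
        obtain ⟨p, hp⟩ := Set.nonempty_iff_ne_empty.mpr hne
        obtain ⟨u, huv, hu, -⟩ := mem_collect_inbox.mp hp
        have h₁ := (ih u).mp (by omega)
        have h₂ := hH.dist_triangle (u := 𝒩.root) (v := u) (w := v)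
        rw [SimpleGraph.dist_eq_one_iff_adj.mpr huv] at h₂
        omega
    · intro h
      by_cases h' : 𝒩.finalSpanner.dist 𝒩.root v ≤ s
      · exact ((ih v).mpr h').trans (level_mono v (Nat.le_succ s))
      · have hv : v ≠ 𝒩.root := by
          rintro rfl
          simp at h'
        obtain ⟨u, huv, hu⟩ := exists_adj_dist_succ hH hv
        obtain ⟨τ, hτ, h₁, h₂⟩ := exists_announcement (v := u) Nat.one_pos ((ih u).mpr (by omega))
        exact (one_le_level_succ huv.symm (h₁.trans_le h₂)).trans
          (level_mono v (Nat.succ_le_succ hτ))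

theorem announced_eq_zero_iff (s : ℕ) (v : V) :
    (collectConfig 𝒩 ω s v).announced = 0 ↔ s ≤ 𝒩.finalSpanner.dist 𝒩.root v := by
  cases s with
  | zero => simp [announced_zero]
  | succ s =>
    have := one_le_level_iff (ω := ω) hH s v
    rw [announced_succ]
    omega

end Reach

end Collecting

/-! ### Informed nodes know the whole network. -/

section Correctness

variable {V : Type} {𝒩 : Network V}

/-- `Descendant v x` if `v` lies on a shortest path of the final spanner from the root to `x`. -/
def Network.Descendant (𝒩 : Network V) : V → V → Prop :=
  Relation.ReflTransGen fun v w => 𝒩.finalSpanner.Adj v w ∧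
    𝒩.finalSpanner.dist 𝒩.root w = 𝒩.finalSpanner.dist 𝒩.root v + 1

theorem descendant_root (hH : 𝒩.finalSpanner.Connected) (v : V) :
    𝒩.Descendant 𝒩.root v := by
  induction hn : 𝒩.finalSpanner.dist 𝒩.root v generalizing v with
  | zero =>
    rw [← hH.dist_eq_zero_iff.mp hn]
    exact Relation.ReflTransGen.refl
  | succ n ih =>
    have hv : v ≠ 𝒩.root := by
      rintro rfl
      simp at hn
    obtain ⟨u, huv, hu⟩ := exists_adj_dist_succ hH hv
    exact (ih u (by omega)).tail ⟨huv.symm, hu⟩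

variable [Fintype V] {ω : V → ℕ → Bool}

theorem own_fact_mem (s : ℕ) (v : V) : 𝒩.fact v ∈ (collectConfig 𝒩 ω s v).known := by
  refine known_mono v (Nat.zero_le s) ?_
  simp only [collectConfig_zero]
  exact Set.mem_singleton _

theorem known_subset (s : ℕ) (v : V) :
    (collectConfig 𝒩 ω s v).known ⊆ Set.range 𝒩.fact := by
  induction s generalizing v with
  | zero =>
    rw [collectConfig_zero]
    rintro f rfl
    exact ⟨v, rfl⟩
  | succ s ih =>
    by_cases h : (collectConfig 𝒩 ω s v).announced = 3
    · rw [collectConfig_succ_of_halted h]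
      exact ih v
    · rw [collectConfig_succ_of_active h]
      rintro f (hf | ⟨p, hp, hf⟩)
      · exact ih v hf
      · obtain ⟨u, -, -, rfl⟩ := mem_collect_inbox.mp hp
        exact ih u hf

theorem known_subset_succ {s : ℕ} {u v : V} (hv : (collectConfig 𝒩 ω s v).announced ≠ 3)
    (huv : 𝒩.finalSpanner.Adj u v)
    (hu : (collectConfig 𝒩 ω s u).announced < (collectConfig 𝒩 ω s u).level) :
    (collectConfig 𝒩 ω s u).known ⊆ (collectConfig 𝒩 ω (s + 1) v).known := by
  rw [collectConfig_succ_of_active hv]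
  exact fun f hf => Or.inr ⟨_, mem_collect_inbox.mpr ⟨u, huv, hu, rfl⟩, hf⟩

/-- A neighbor farther from the root counts as done only when its facts have arrived; a node of
level at least two knows the facts of its descendants, and a node of level three knows all. -/
theorem known_invariant (hH : 𝒩.finalSpanner.Connected) (s : ℕ) :
    (∀ v w, 𝒩.finalSpanner.Adj v w →
      𝒩.finalSpanner.dist 𝒩.root w = 𝒩.finalSpanner.dist 𝒩.root v + 1 →
      𝒩.ident w ∈ (collectConfig 𝒩 ω s v).done →
      ∀ x, 𝒩.Descendant w x → 𝒩.fact x ∈ (collectConfig 𝒩 ω s v).known) ∧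
    (∀ v, 2 ≤ (collectConfig 𝒩 ω s v).level →
      ∀ x, 𝒩.Descendant v x → 𝒩.fact x ∈ (collectConfig 𝒩 ω s v).known) ∧
    (∀ v, (collectConfig 𝒩 ω s v).level = 3 →
      ∀ x, 𝒩.fact x ∈ (collectConfig 𝒩 ω s v).known) := by
  induction s with
  | zero =>
    have hlevel : ∀ v, (collectConfig 𝒩 ω 0 v).level ≤ 1 := by
      intro v
      rw [collectConfig_zero]
      simp only [Network.buildingConfig, BFSState.building]
      split_ifs <;> simp
    refine ⟨fun v w _ _ h => ?_, fun v h => absurd (hlevel v) (by omega),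
      fun v h => absurd (hlevel v) (by omega)⟩
    rw [collectConfig_zero] at h
    exact absurd h (Set.notMem_empty _)
  | succ s ih =>
    obtain ⟨ih₁, ih₂, ih₃⟩ := ih
    have hdone : ∀ v w, 𝒩.finalSpanner.Adj v w →
        𝒩.finalSpanner.dist 𝒩.root w = 𝒩.finalSpanner.dist 𝒩.root v + 1 →
        𝒩.ident w ∈ (collectConfig 𝒩 ω (s + 1) v).done →
        ∀ x, 𝒩.Descendant w x → 𝒩.fact x ∈ (collectConfig 𝒩 ω (s + 1) v).known := by
      intro v w hvw hd hw x hx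
      by_cases h : (collectConfig 𝒩 ω s v).announced = 3
      · rw [collectConfig_succ_of_halted h] at hw ⊢
        exact ih₁ v w hvw hd hw x hx
      · have hw' := hw
        rw [collectConfig_succ_of_active h] at hw'
        rcases hw' with hw' | ⟨m, hm, hcase⟩
        · exact known_mono v (Nat.le_succ s) (ih₁ v w hvw hd hw' x hx)
        · obtain ⟨u, huv, hu, hpair⟩ := mem_collect_inbox.mp hm
          obtain ⟨hid, rfl⟩ := Prod.mk.inj hpair
          obtain rfl := 𝒩.ident_injective hid
          refine known_subset_succ h huv hu ?_
          rcases hcase with h0 | h2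
          -- This case is impossible: `announced = 0` at `v` means that the wave has not passed
          -- beyond the layer of `v`, while the sender `w` lies one layer farther and has already
          -- been reached.
          · have h₁ := (announced_eq_zero_iff hH s v).mp h0
            have h₂ := (one_le_level_iff (ω := ω) hH s w).mp (by omega)
            omega
          · exact ih₂ w h2 x hx
    have hready : ∀ v, (collectConfig 𝒩 ω s v).links ⊆ (collectConfig 𝒩 ω (s + 1) v).done →
        ∀ x, 𝒩.Descendant v x → 𝒩.fact x ∈ (collectConfig 𝒩 ω (s + 1) v).known := by
      intro v hsub x hx
      -- A descendant is either `v` itself or a descendant of a neighbor one layer farther, and that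
      -- neighbor is done.
      rcases Relation.ReflTransGen.cases_head hx with rfl | ⟨w, ⟨hvw, hd⟩, hwx⟩
      · exact own_fact_mem _ _
      · refine hdone v w hvw hd (hsub ?_) x hwx
        rw [(collectConfig_static s v).2.1]
        exact ident_mem_linkIds.mpr hvw
    have hinformed : ∀ v, (collectConfig 𝒩 ω s v).announced ≠ 3 →
        (∃ p ∈ bfsInbox 𝒩 (collectConfig 𝒩 ω s) v, p.2.level = 3) →
        ∀ x, 𝒩.fact x ∈ (collectConfig 𝒩 ω (s + 1) v).known := by
      rintro v h ⟨p, hp, hp3⟩ x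
      obtain ⟨u, huv, hu, rfl⟩ := mem_collect_inbox.mp hp
      exact known_subset_succ h huv hu (ih₃ u hp3 x)
    have hnew : ∀ v, (collectConfig 𝒩 ω s v).announced ≠ 3 →
        (collectConfig 𝒩 ω (s + 1) v).done = (collectConfig 𝒩 ω s v).newDone
          (bfsInbox 𝒩 (collectConfig 𝒩 ω s) v) := by
      intro v h
      rw [collectConfig_succ_of_active h]
      rfl
    have hcollected : ∀ v, 2 ≤ (collectConfig 𝒩 ω (s + 1) v).level →
        ∀ x, 𝒩.Descendant v x → 𝒩.fact x ∈ (collectConfig 𝒩 ω (s + 1) v).known := by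
      intro v h2 x hx
      by_cases hold : 2 ≤ (collectConfig 𝒩 ω s v).level
      · exact known_mono v (Nat.le_succ s) (ih₂ v hold x hx)
      · have hact : (collectConfig 𝒩 ω s v).announced ≠ 3 := by
          have := (level_announced_bounds (𝒩 := 𝒩) (ω := ω) s v).1
          omega
        rw [level_succ_of_active hact] at h2
        rcases BFSState.links_subset_of_two_le_newLevel
          ((le_max_iff.mp h2).resolve_left hold) with h | h
        · exact hinformed v hact h x
        · exact hready v (by rwa [hnew v hact]) x hx
    refine ⟨hdone, hcollected, fun v h3 x => ?_⟩
    by_cases hold : (collectConfig 𝒩 ω s v).level = 3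
    · exact known_mono v (Nat.le_succ s) (ih₃ v hold x)
    · have hb := level_announced_bounds (𝒩 := 𝒩) (ω := ω) s v
      have hact : (collectConfig 𝒩 ω s v).announced ≠ 3 := by omega
      have hl := level_succ_of_active hact
      rcases BFSState.isRoot_of_newLevel_eq_three
        (s := collectConfig 𝒩 ω s v) (M := bfsInbox 𝒩 (collectConfig 𝒩 ω s) v)
        (by omega) with h | h
      · exact hinformed v hact h x
      -- Only the root can create level `3`, and every node is a descendant of the root.
      · rw [(collectConfig_static s v).1] at h
        obtain rfl : v = 𝒩.root := h
        exact hcollected _ (by omega) x (descendant_root hH x)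

theorem known_eq_of_level_eq_three (hH : 𝒩.finalSpanner.Connected) {s : ℕ} {v : V}
    (h : (collectConfig 𝒩 ω s v).level = 3) :
    (collectConfig 𝒩 ω s v).known = Set.range 𝒩.fact := by
  refine (known_subset s v).antisymm ?_
  rintro _ ⟨x, rfl⟩
  exact (known_invariant hH s).2.2 v h x

end Correctness

/-! ### Running time of the second stage. -/

section Termination

variable {V : Type} [Fintype V] {𝒩 : Network V} {ω : V → ℕ → Bool}

theorem level_succ_of_links_subset {s : ℕ} {v : V}
    (hact : (collectConfig 𝒩 ω s v).announced ≠ 3)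
    (h1 : 1 ≤ (collectConfig 𝒩 ω s v).level)
    (hd : ∀ w, 𝒩.finalSpanner.Adj v w → 𝒩.ident w ∈ (collectConfig 𝒩 ω (s + 1) v).done) :
    2 ≤ (collectConfig 𝒩 ω (s + 1) v).level ∧
      (v = 𝒩.root → (collectConfig 𝒩 ω (s + 1) v).level = 3) := by
  have hb := (level_announced_bounds (𝒩 := 𝒩) (ω := ω) (s + 1) v).2
  have hsub : (collectConfig 𝒩 ω s v).links ⊆
      (collectConfig 𝒩 ω s v).newDone (bfsInbox 𝒩 (collectConfig 𝒩 ω s) v) := by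
    rw [(collectConfig_static s v).2.1]
    rintro _ ⟨w, hw, rfl⟩
    have := hd w hw
    rwa [collectConfig_succ_of_active hact] at this
  have hne : (collectConfig 𝒩 ω s v).newLevel (bfsInbox 𝒩 (collectConfig 𝒩 ω s) v) ≠ 0 := by
    intro h0
    have := (BFSState.newLevel_eq_zero.mp h0).1
    omega
  have hl := level_succ_of_active hact
  have h₂ := BFSState.two_le_newLevel hne hsub
  refine ⟨by omega, fun hv => ?_⟩
  have h₃ := BFSState.newLevel_eq_three_of_isRoot hne hsub (by
    rw [(collectConfig_static s v).1]
    exact hv)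
  omega

/-- The first announcement of `w` is made in round `dist w ≤ dist v`, when `v` has not announced
anything, so it settles `w` whatever its level. -/
theorem mem_done_of_dist_le (hH : 𝒩.finalSpanner.Connected) {s : ℕ} {v w : V}
    (hvw : 𝒩.finalSpanner.Adj v w)
    (hd : 𝒩.finalSpanner.dist 𝒩.root w ≤ 𝒩.finalSpanner.dist 𝒩.root v)
    (hs : 𝒩.finalSpanner.dist 𝒩.root v ≤ s) :
    𝒩.ident w ∈ (collectConfig 𝒩 ω (s + 1) v).done := by
  have h₁ := (one_le_level_iff (ω := ω) hH _ w).mpr le_rfl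
  have h₂ := (announced_eq_zero_iff (ω := ω) hH _ w).mpr le_rfl
  have h₃ := (announced_eq_zero_iff (ω := ω) hH _ v).mpr hd
  exact done_mono v (Nat.succ_le_succ (hd.trans hs))
    (mem_done_succ (by omega) hvw.symm (by omega) (Or.inl h₃))

theorem mem_done_of_two_le_level {s : ℕ} {v w : V}
    (hact : (collectConfig 𝒩 ω s v).announced ≠ 3) (hvw : 𝒩.finalSpanner.Adj v w)
    (hw : 2 ≤ (collectConfig 𝒩 ω s w).level) :
    𝒩.ident w ∈ (collectConfig 𝒩 ω (s + 1) v).done := by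
  obtain ⟨τ, hτ, h₁, h₂⟩ := exists_announcement Nat.two_pos hw
  refine done_mono v (Nat.succ_le_succ hτ)
    (mem_done_succ ?_ hvw.symm (h₁.trans_le h₂) (Or.inr h₂))
  have := announced_mono (𝒩 := 𝒩) (ω := ω) v hτ
  have := level_announced_bounds (𝒩 := 𝒩) (ω := ω) s v
  simp only at *
  omega

/-- If no node is farther than `m` from the root, then the facts of all nodes at distance at least
`m - j` have been collected after `m + j + 1` rounds. -/
theorem level_of_dist (hH : 𝒩.finalSpanner.Connected) {m : ℕ}
    (hm : ∀ v, 𝒩.finalSpanner.dist 𝒩.root v ≤ m) (j : ℕ) (v : V)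
    (hv : m ≤ 𝒩.finalSpanner.dist 𝒩.root v + j) :
    2 ≤ (collectConfig 𝒩 ω (m + j + 1) v).level ∧
      (v = 𝒩.root → (collectConfig 𝒩 ω (m + j + 1) v).level = 3) := by
  induction j generalizing v with
  | zero =>
    by_cases hact : (collectConfig 𝒩 ω (m + 0) v).announced = 3
    · have h₁ := level_announced_bounds (𝒩 := 𝒩) (ω := ω) (m + 0) v
      rw [collectConfig_succ_of_halted hact]
      omega
    · refine level_succ_of_links_subset hact ((one_le_level_iff hH _ v).mpr (hm v)) ?_
      -- For `j = 0` the node `v` lies in a layer at the maximal distance `m`, so no neighbor is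
      -- farther and nothing has to be awaited.
      exact fun w hvw => mem_done_of_dist_le hH hvw ((hm w).trans hv) (hm v)
  | succ j ih =>
    by_cases hact : (collectConfig 𝒩 ω (m + (j + 1)) v).announced = 3
    · have h₁ := level_announced_bounds (𝒩 := 𝒩) (ω := ω) (m + (j + 1)) v
      rw [collectConfig_succ_of_halted hact]
      omega
    · have hvs : 𝒩.finalSpanner.dist 𝒩.root v ≤ m + (j + 1) := (hm v).trans (Nat.le_add_right _ _)
      refine level_succ_of_links_subset hact ((one_le_level_iff hH _ v).mpr hvs) ?_
      intro w hvw
      by_cases hd : 𝒩.finalSpanner.dist 𝒩.root w ≤ 𝒩.finalSpanner.dist 𝒩.root v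
      · exact mem_done_of_dist_le hH hvw hd hvs
      · exact mem_done_of_two_le_level hact hvw (ih w (by omega)).1

theorem level_succ_of_adj {s : ℕ} {u v : V} (huv : 𝒩.finalSpanner.Adj u v)
    (hu : (collectConfig 𝒩 ω s u).level = 3) : (collectConfig 𝒩 ω (s + 1) v).level = 3 := by
  obtain ⟨τ, hτ, h₁, h₂⟩ := exists_announcement (Nat.succ_pos 2) hu.ge
  have hb := (level_announced_bounds (𝒩 := 𝒩) (ω := ω) (s + 1) v).2
  have hmono := level_mono (𝒩 := 𝒩) (ω := ω) v (Nat.succ_le_succ hτ)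
  have hbu := (level_announced_bounds (𝒩 := 𝒩) (ω := ω) τ u).2
  simp only [Nat.succ_eq_add_one] at hmono
  have : 3 ≤ (collectConfig 𝒩 ω (τ + 1) v).level := by
    by_cases hact : (collectConfig 𝒩 ω τ v).announced = 3
    · rw [collectConfig_succ_of_halted hact, ← hact]
      exact (level_announced_bounds τ v).1
    · have h3 := BFSState.newLevel_eq_three_of_mem (s := collectConfig 𝒩 ω τ v)
        ⟨_, mem_collect_inbox.mpr ⟨u, huv, h₁.trans_le h₂, rfl⟩, hbu.antisymm h₂⟩
      have hl := level_succ_of_active hact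
      omega
  omega

/-- The wave and the gathering bring the root to level `3` within `2 * m + 1` rounds; the broadcast
takes one more round per layer. -/
theorem level_eq_three (hH : 𝒩.finalSpanner.Connected) {m : ℕ}
    (hm : ∀ v, 𝒩.finalSpanner.dist 𝒩.root v ≤ m) (v : V) :
    (collectConfig 𝒩 ω (3 * m + 1) v).level = 3 := by
  have key : ∀ (n : ℕ) (v : V), 𝒩.finalSpanner.dist 𝒩.root v = n →
      (collectConfig 𝒩 ω (m + m + 1 + n) v).level = 3 := by
    intro n
    induction n with
    | zero =>
      intro v hv
      exact (level_of_dist hH hm m v (Nat.le_add_left _ _)).2 (hH.dist_eq_zero_iff.mp hv).symm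
    | succ n ih =>
      intro v hv
      have hvr : v ≠ 𝒩.root := by
        rintro rfl
        simp at hv
      obtain ⟨u, huv, hu⟩ := exists_adj_dist_succ hH hvr
      exact level_succ_of_adj huv.symm (ih u (by omega))
  have h₁ := key _ v rfl
  have h₂ := level_mono (𝒩 := 𝒩) (ω := ω) v
    (show m + m + 1 + 𝒩.finalSpanner.dist 𝒩.root v ≤ 3 * m + 1 by have := hm v; omega)
  have h₃ := (level_announced_bounds (𝒩 := 𝒩) (ω := ω) (3 * m + 1) v).2
  simp only at h₂
  omega

/-- One round is added to the `3 * m + 1` above, because a node halts only after announcing level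
`3`, that is, after passing the facts on. -/
theorem haltsWith_treeOutput (hH : 𝒩.finalSpanner.Connected) {m : ℕ}
    (hm : ∀ v, 𝒩.finalSpanner.dist 𝒩.root v ≤ m) :
    bfsAlgorithm.HaltsWith 𝒩 ω (spannerTime 𝒩.idBound + (3 * m + 2))
      fun v => treeOutput (Set.range 𝒩.fact) (𝒩.input (ω v) v) := by
  intro v
  have h := level_eq_three (ω := ω) hH hm v
  have ha : (collectConfig 𝒩 ω (3 * m + 2) v).announced = 3 := by
    rw [announced_succ, h]
  have hl : (collectConfig 𝒩 ω (3 * m + 2) v).level = 3 := by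
    have := level_announced_bounds (𝒩 := 𝒩) (ω := ω) (3 * m + 2) v
    omega
  refine (if_pos ha).trans (congrArg some ?_)
  change treeOutput (collectConfig 𝒩 ω (3 * m + 2) v).known
    (collectConfig 𝒩 ω (3 * m + 2) v).input = _
  rw [known_eq_of_level_eq_three hH hl, (collectConfig_static (3 * m + 2) v).1]

end Termination

/-! ### Counting messages. -/

section MessageCount

variable {V : Type} [Fintype V] {𝒩 : Network V} {ω : V → ℕ → Bool}

/-- Each announcing round raises `announced` by at least one, so `announced` itself, which never
exceeds `3`, bounds their number. -/
theorem card_announcing_le (S : ℕ) (v : V) :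
    ((Finset.range S).filter fun s =>
      (collectConfig 𝒩 ω s v).announced < (collectConfig 𝒩 ω s v).level).card ≤
      (collectConfig 𝒩 ω S v).announced := by
  induction S with
  | zero => simp
  | succ S ih =>
    have := (level_announced_bounds (𝒩 := 𝒩) (ω := ω) S v).1
    rw [Finset.range_add_one, Finset.filter_insert, announced_succ]
    split_ifs with h
    · exact (Finset.card_insert_le _ _).trans (by omega)
    · omega

theorem sum_collect_roundMessages_le (S : ℕ) :
    ∑ s ∈ Finset.range S, bfsAlgorithm.roundMessages 𝒩
      (bfsAlgorithm.config 𝒩 ω (spannerTime 𝒩.idBound + s)) ≤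
      3 * Set.ncard {p : V × V | 𝒩.finalSpanner.Adj p.1 p.2} := by
  classical
  let E : Finset (V × V) := Finset.univ.filter fun p => 𝒩.finalSpanner.Adj p.1 p.2
  have hE : Set.ncard {p : V × V | 𝒩.finalSpanner.Adj p.1 p.2} = E.card := by
    rw [← Set.ncard_coe_finset]
    congr 1
    ext p
    simp [E]
  have hround : ∀ s, bfsAlgorithm.roundMessages 𝒩
      (bfsAlgorithm.config 𝒩 ω (spannerTime 𝒩.idBound + s)) ≤
      (E.filter fun p => (collectConfig 𝒩 ω s p.1).announced <
        (collectConfig 𝒩 ω s p.1).level).card := by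
    intro s
    rw [roundMessages_eq, ← Set.ncard_coe_finset]
    refine Set.ncard_le_ncard ?_ (Finset.finite_toSet _)
    rintro ⟨u, v⟩ ⟨-, -, h⟩
    obtain ⟨h₁, h₂⟩ := collect_sends_iff.mp h
    simpa [E] using ⟨h₂, h₁⟩
  calc _ ≤ ∑ s ∈ Finset.range S, (E.filter fun p => (collectConfig 𝒩 ω s p.1).announced <
          (collectConfig 𝒩 ω s p.1).level).card := Finset.sum_le_sum fun s _ => hround s
    _ = ∑ p ∈ E, ((Finset.range S).filter fun s => (collectConfig 𝒩 ω s p.1).announced <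
          (collectConfig 𝒩 ω s p.1).level).card := by
        simp only [Finset.card_filter]
        exact Finset.sum_comm
    _ ≤ ∑ p ∈ E, 3 := Finset.sum_le_sum fun p _ =>
        (card_announcing_le S p.1).trans
          ((level_announced_bounds S p.1).1.trans (level_announced_bounds S p.1).2)
    _ = _ := by rw [hE, Finset.sum_const, smul_eq_mul, mul_comm]

theorem messages_le (S : ℕ) :
    bfsAlgorithm.messages 𝒩 ω (spannerTime 𝒩.idBound + S) ≤
      (spannerTime 𝒩.idBound + 3) * (2 * phases 𝒩.idBound * Fintype.card V) := by
  have hcard := ncard_spanner_adj_le (G := 𝒩.graph) (k := 2 * phases 𝒩.idBound)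
    𝒩.ident_injective (phases 𝒩.idBound)
  rw [Nat.card_eq_fintype_card] at hcard
  refine le_trans ?_ (Nat.mul_le_mul_left _ hcard)
  rw [Algorithm.messages, Finset.sum_range_add, add_mul]
  refine add_le_add ?_ (sum_collect_roundMessages_le S)
  refine (Finset.sum_le_card_nsmul _ _ _ fun t ht =>
    roundMessages_le_of_lt_spannerTime (Finset.mem_range.mp ht)).trans ?_
  rw [Finset.card_range, smul_eq_mul]
  rfl

end MessageCount

/-! ### Explicit bounds and the asymptotic estimates. -/

section Main

variable {V : Type} [Fintype V] {𝒩 : Network V}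

theorem card_lt_two_pow_phases : Nat.card V < 2 ^ phases 𝒩.idBound := by
  have h : Fintype.card V ≤ 𝒩.idBound := by
    have := Fintype.card_le_of_injective (fun v => (⟨𝒩.ident v, 𝒩.ident_lt v⟩ : Fin 𝒩.idBound))
      fun u v huv => 𝒩.ident_injective (congrArg Fin.val huv)
    simpa using this
  rw [Nat.card_eq_fintype_card]
  exact h.trans_lt (Nat.lt_pow_succ_log_self one_lt_two _)

/-- The algorithm always succeeds, with explicit bounds. -/
theorem bfsAlgorithm_buildsBFSTreeWithin (hG : 𝒩.graph.Connected) (ω : V → ℕ → Bool) :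
    bfsAlgorithm.BuildsBFSTreeWithin 𝒩 ω
      (phases 𝒩.idBound * (2 * phases 𝒩.idBound + 1) +
        (6 * (𝒩.graph.diam * phases 𝒩.idBound) + 2))
      ((phases 𝒩.idBound * (2 * phases 𝒩.idBound + 1) + 3) *
        (2 * phases 𝒩.idBound * Fintype.card V)) := by
  have hstretch : ∀ u v, 𝒩.graph.Adj u v →
      Within 𝒩.finalSpanner (2 * phases 𝒩.idBound) u v := fun u v huv =>
    within_spanner 𝒩.ident_injective le_rfl card_lt_two_pow_phases huv
  have := hG.nonempty
  have hdiam : ∀ v, 𝒩.graph.dist 𝒩.root v ≤ 𝒩.graph.diam := fun v =>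
    SimpleGraph.dist_le_diam (SimpleGraph.connected_iff_ediam_ne_top.mp hG)
  have hm : ∀ v, 𝒩.finalSpanner.dist 𝒩.root v ≤ 𝒩.graph.diam * (2 * phases 𝒩.idBound) :=
    fun v => (dist_le_mul_of_stretch hG hstretch _ _).trans (Nat.mul_le_mul_right _ (hdiam v))
  have hH := connected_of_stretch hG hstretch
  obtain ⟨T, hT, hrep⟩ := exists_tree_represents hG ω
  refine ⟨_, _, T, ?_, haltsWith_treeOutput hH hm, ?_, hT, hrep⟩
  · rw [spannerTime, phaseLength]
    push_cast
    linarith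
  · exact_mod_cast messages_le _

/-- The number of phases is logarithmic in the number of nodes. -/
theorem phases_le_log {n N a : ℕ} (hn : 2 ≤ n) (hN : N ≤ n ^ a) :
    (phases N : ℝ) ≤ 2 * (a + 1) * Real.log n := by
  have hlog : Real.log 2 ≤ Real.log n :=
    Real.log_le_log two_pos (by exact_mod_cast hn)
  -- Only `log 2 > 1/2` matters: it turns the binary logarithm into at most twice the natural one
  -- and absorbs the additive `1` of `phases` into `2 * log n`.
  have h2 := Real.log_two_gt_d9
  have h₁ : (Nat.log 2 N : ℝ) * Real.log 2 ≤ a * Real.log n := by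
    rcases Nat.eq_zero_or_pos N with rfl | hpos
    · simp only [Nat.log_zero_right, Nat.cast_zero, zero_mul]
      have : 0 ≤ Real.log n := by linarith
      positivity
    · rw [← Real.log_pow, ← Real.log_pow]
      refine Real.log_le_log (by positivity) ?_
      exact_mod_cast (Nat.pow_log_le_self 2 hpos.ne').trans hN
  have h₃ : (0 : ℝ) ≤ Nat.log 2 N := Nat.cast_nonneg _
  rw [phases]
  push_cast
  nlinarith

theorem Algorithm.BuildsBFSTreeWithin.mono {A : Algorithm TreeOutput} {ω : V → ℕ → Bool}
    {R R' M M' : ℝ}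
    (h : A.BuildsBFSTreeWithin 𝒩 ω R M) (hR : R ≤ R') (hM : M ≤ M') :
    A.BuildsBFSTreeWithin 𝒩 ω R' M' := by
  obtain ⟨t, out, T, h₁, h₂, h₃, h₄⟩ := h
  exact ⟨t, out, T, h₁.trans hR, h₂, h₃.trans hM, h₄⟩

/-- The bounds of the algorithm in terms of the number of nodes and the diameter. -/
theorem rounds_le {k b x D : ℝ} (hk : 1 ≤ k) (hb : 2 ≤ b) (hx : 1 / 2 ≤ x) (hD : 0 ≤ D)
    (hkx : k ≤ b * x) :
    k * (2 * k + 1) + (6 * (D * k) + 2) ≤ 12 * b ^ 3 * (D * x + x ^ 3) := by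
  have h₁ : k ^ 2 ≤ (b * x) ^ 2 := pow_le_pow_left₀ (by linarith) hkx 2
  have h₂ : D * k ≤ D * (b * x) := mul_le_mul_of_nonneg_left hkx hD
  have h₃ : b ^ 2 ≤ b ^ 3 := pow_le_pow_right₀ (by linarith) (by norm_num)
  have h₄ : b ≤ b ^ 3 := le_self_pow₀ (by linarith) (by norm_num)
  -- The construction costs only a square of the logarithm; `1 / 2 ≤ x` lifts it to the cube in the
  -- stated bound.
  have h₅ : x ^ 2 ≤ 2 * x ^ 3 := by nlinarith [sq_nonneg x]
  have h₆ : 0 ≤ D * x := mul_nonneg hD (by linarith)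
  calc k * (2 * k + 1) + (6 * (D * k) + 2) ≤ 5 * k ^ 2 + 6 * (D * k) := by nlinarith
    _ ≤ 5 * (b ^ 2 * x ^ 2) + 6 * (b * (D * x)) := by
        rw [mul_pow] at h₁
        linarith
    _ ≤ 5 * (b ^ 3 * (2 * x ^ 3)) + 6 * (b ^ 3 * (D * x)) := by gcongr
    _ ≤ 12 * b ^ 3 * (D * x + x ^ 3) := by
        have h₇ : 0 ≤ b ^ 3 * x ^ 3 := by positivity
        have h₈ : 0 ≤ b ^ 3 * (D * x) := by positivity
        linarith

theorem messages_bound_le {k b x n : ℝ} (hk : 1 ≤ k) (hn : 0 ≤ n) (hkx : k ≤ b * x) :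
    (k * (2 * k + 1) + 3) * (2 * k * n) ≤ 12 * b ^ 3 * (n * x ^ 3) := by
  have h₁ : k ^ 3 ≤ (b * x) ^ 3 := pow_le_pow_left₀ (by linarith) hkx 3
  calc (k * (2 * k + 1) + 3) * (2 * k * n) ≤ (6 * k ^ 2) * (2 * k * n) := by
        refine mul_le_mul_of_nonneg_right ?_ (by positivity)
        nlinarith
    _ = 12 * n * k ^ 3 := by ring
    _ ≤ 12 * n * (b * x) ^ 3 := by gcongr
    _ = 12 * b ^ 3 * (n * x ^ 3) := by ring

end Main

end KT1Local

theorem theorem1 (c : ℕ) :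
    ∃ A : KT1Local.Algorithm KT1Local.TreeOutput, ∀ a : ℕ, ∃ C : ℝ,
      ∀ (V : Type) [Fintype V] (𝒩 : KT1Local.Network V),
        𝒩.graph.Connected →
        𝒩.idBound ≤ Fintype.card V ^ a →
        KT1Local.coinMeasure V
          {ω | ¬ A.BuildsBFSTreeWithin 𝒩 ω
            (C * (𝒩.graph.diam * Real.log (Fintype.card V) + Real.log (Fintype.card V) ^ 3))
            (C * (Fintype.card V * Real.log (Fintype.card V) ^ 3))} ≤
          ENNReal.ofReal (1 / (Fintype.card V : ℝ) ^ c) := by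
  -- The constant is `12 * b ^ 3` from `rounds_le` and `messages_bound_le`, with `b = 2 * (a + 1)`
  -- from `phases_le_log`.
  refine ⟨KT1Local.bfsAlgorithm, fun a => ⟨12 * (2 * (a + 1)) ^ 3, fun V _ 𝒩 hG hN => ?_⟩⟩
  have hpos : 0 < Fintype.card V := Fintype.card_pos_iff.mpr hG.nonempty
  rcases Nat.lt_or_ge (Fintype.card V) 2 with hn | hn
  -- For a single node the logarithm vanishes and so do both resource bounds, but the allowed
  -- failure probability is `1`.
  · have hone : Fintype.card V = 1 := by omega
    have : IsProbabilityMeasure (KT1Local.coinMeasure V) := by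
      unfold KT1Local.coinMeasure
      infer_instance
    simpa [hone] using prob_le_one
  · have hx : 1 / 2 ≤ Real.log (Fintype.card V) := by
      have h₁ : Real.log 2 ≤ Real.log (Fintype.card V) :=
        Real.log_le_log two_pos (by exact_mod_cast hn)
      have h₂ := Real.log_two_gt_d9
      linarith
    have hk : (1 : ℝ) ≤ KT1Local.phases 𝒩.idBound :=
      Nat.one_le_cast.mpr (Nat.succ_le_succ (Nat.zero_le _))
    have hkx := KT1Local.phases_le_log hn hN
    have ha : (0 : ℝ) ≤ a := Nat.cast_nonneg a
    have hempty : {ω | ¬ KT1Local.bfsAlgorithm.BuildsBFSTreeWithin 𝒩 ω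
        (12 * (2 * (a + 1)) ^ 3 *
          (𝒩.graph.diam * Real.log (Fintype.card V) + Real.log (Fintype.card V) ^ 3))
        (12 * (2 * (a + 1)) ^ 3 * (Fintype.card V * Real.log (Fintype.card V) ^ 3))} = ∅ := by
      refine Set.eq_empty_iff_forall_notMem.mpr fun ω hω => hω ?_
      exact (KT1Local.bfsAlgorithm_buildsBFSTreeWithin hG ω).mono
        (KT1Local.rounds_le hk (by linarith) hx (Nat.cast_nonneg _) hkx)
        (KT1Local.messages_bound_le hk (Nat.cast_nonneg _) hkx)
    rw [hempty, measure_empty]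
    exact zero_le
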